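/- **Theorem.** For real $s\ge 0$ and $0\le t\le 1$ let $$\mathfrak A_s^t=\Big\{f\in\mathcal A:\ \operatorname{Re}\Big[(s-1)\frac{f(z)}{z}+f'(z)\Big]\ge st,\ z\in\mathbb D\setminus\{0\}\Big\},\qquad \mathfrak A_\infty^t=\Big\{f\in\mathcal A:\ \operatorname{Re}\frac{f(z)}{z}\ge t,\ z\in\mathbb D\setminus\{0\}\Big\},$$ where $\mathcal A$ is the set of holomorphic functions $f$ on the open unit disk $\mathbb D$ with $f(0)=f'(0)-1=0$. Let $\mathfrak A$ be the family of all sets $\mathfrak A_s^t$, $(s,t)\in[0,\infty)\times[0,1]$, and $\mathfrak A_\infty^t$, $t\in[0,1]$, ordered by inclusion. For $\mathfrak A_1,\mathfrak A_2\in\mathfrak A$, a set $\mathfrak A_0\in\mathfrak A$ is a *quasi-supremum* of the pair if $\mathfrak A_1\cup\mathfrak A_2\subset\mathfrak A_0$ and there is no $\mathfrak A_*\in\mathfrak A$ with $\mathfrak A_1\cup\mathfrak A_2\subset\mathfrak A_*\subsetneq\mathfrak A_0$; it is a *quasi-infimum* if $\mathfrak A_0\subset\mathfrak A_1\cap\mathfrak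 A_2$ and there is no $\mathfrak A_*\in\mathfrak A$ with $\mathfrak A_0\subsetneq\mathfrak A_*\subset\mathfrak A_1\cap\mathfrak A_2$. Let $\xi_0(s)=\int_0^1\frac{1-x}{1+x}\,s x^{s-1}\,dx$ for $s>0$ and $\xi_0(0)=1$. For $P_0=(s_0,t_0)\in\Omega=[0,\infty)\times[0,1)$ put $$t_{\uparrow,P_0}(s)=t_0+(1-t_0)\Big(1-\frac{s_0}{s}\Big)\xi_0(s_0)\quad(s\ge s_0,\ s>0),\qquad t_{\uparrow,P_0}(\infty)=t_0+(1-t_0)\,\xi_0(s_0),$$ and, for $0<s\le s_0$, let $t_{\downarrow,P_0}(s)\in\mathbb R$ be the unique solution $t$ of $t_0=t+(1-t)\big(1-\frac{s}{s_0}\big)\xi_0(s)$, that is, $$t_{\downarrow,P_0}(s)=\frac{t_0-(1-s/s_0)\,\xi_0(s)}{1-(1-s/s_0)\,\xi_0(s)}.$$ Let $P_1=(s_1,t_1)$ and $P_2=(s_2,t_2)$ be points of $\Omega$ with $s_1<s_2$ such that $P_2$ lies above the forward extremal curve of $P_1$, that is, $t_2>t_{\uparrow,P_1}(s_2)$. Then: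 (a) the quasi-suprema of the pair $\mathfrak A_{s_1}^{t_1},\mathfrak A_{s_2}^{t_2}$ in $\mathfrak A$ are exactly the sets $\mathfrak A_s^{\tau_1(s)}$ with $s_2\le s\le\infty$, where $\tau_1(s)=\min\{t_{\uparrow,P_1}(s),t_{\uparrow,P_2}(s)\}$; (b) the quasi-infima of this pair in $\mathfrak A$ are exactly the sets $\mathfrak A_s^{\tau_2(s)}$ with $0<s\le s_1$ and $\tau_2(s)\ge 0$, where $\tau_2(s)=\max\{t_{\downarrow,P_1}(s),t_{\downarrow,P_2}(s)\}$. The same holds, with $s_2\le s<\infty$ in (a), if $\mathfrak A$ is replaced by the family of the sets $\mathfrak A_s^t$ with $(s,t)\in[0,\infty)\times[0,1]$ only. -/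

import Mathlib

open Set Metric Filter Topology

/-- The class `𝒜` of holomorphic functions on the open unit disk with `f(0) = f'(0) - 1 = 0`.
A function on the disk is represented by any function `ℂ → ℂ` restricting to it: membership here and
in the sets below depends only on the values in the open disk, so inclusions and equalities between
these sets are the same as for sets of functions on the disk. -/
def NormalizedHol : Set (ℂ → ℂ) :=
  {f | DifferentiableOn ℂ f (ball 0 1) ∧ f 0 = 0 ∧ deriv f 0 = 1}

/-- The set `𝔄_s^t`, for `0 ≤ s < ∞`. -/
def setA (s t : ℝ) : Set (ℂ → ℂ) :=
  {f | f ∈ NormalizedHol ∧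
    ∀ z ∈ ball (0 : ℂ) 1, z ≠ 0 → s * t ≤ (((s : ℂ) - 1) * (f z / z) + deriv f z).re}

/-- The set `𝔄_∞^t`. -/
def setAInf (t : ℝ) : Set (ℂ → ℂ) :=
  {f | f ∈ NormalizedHol ∧ ∀ z ∈ ball (0 : ℂ) 1, z ≠ 0 → t ≤ (f z / z).re}

/-- The parameter region `Ω = [0,∞) × [0,1)`. -/
def Omega : Set (ℝ × ℝ) := Ici 0 ×ˢ Ico 0 1

/-- The sets `𝔄_s^t` with finite `s`: `(s,t)` ranges over the closure of `Ω`. -/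
def familyFin : Set (Set (ℂ → ℂ)) := {C | ∃ P ∈ closure Omega, C = setA P.1 P.2}

/-- The whole two-parameter family `𝔄`, including the sets `𝔄_∞^t`. -/
def familyA : Set (Set (ℂ → ℂ)) := familyFin ∪ {C | ∃ t ∈ Icc (0 : ℝ) 1, C = setAInf t}

/-- The quasi-suprema of the pair `A, B` in the family `F` (ordered by inclusion). -/
def qsup {X : Type*} (F : Set (Set X)) (A B : Set X) : Set (Set X) :=
  {C | C ∈ F ∧ A ∪ B ⊆ C ∧ ¬ ∃ D ∈ F, A ∪ B ⊆ D ∧ D ⊂ C}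

/-- The quasi-infima of the pair `A, B` in the family `F` (ordered by inclusion). -/
def qinf {X : Type*} (F : Set (Set X)) (A B : Set X) : Set (Set X) :=
  {C | C ∈ F ∧ C ⊆ A ∩ B ∧ ¬ ∃ D ∈ F, C ⊂ D ∧ D ⊆ A ∩ B}

/-- `ξ₀(s) = 2 ₂F₁(1,s;s+1;-1) - 1 = ∫₀¹ (1-x)/(1+x) s x^(s-1) dx` for `s > 0`,
extended by continuity: `ξ₀(0) = 1`. -/
noncomputable def xi0 (s : ℝ) : ℝ :=
  if s = 0 then 1 else ∫ x in (0 : ℝ)..1, (1 - x) / (1 + x) * (s * x ^ (s - 1))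

/-- `t_{↑,P₀}(s)`, for `s ≥ s₀`; its graph is the forward extremal curve of `P₀ = (s₀,t₀)`. -/
noncomputable def tUp (P : ℝ × ℝ) (s : ℝ) : ℝ :=
  P.2 + (1 - P.2) * (1 - P.1 / s) * xi0 P.1

/-- The value `t_{↑,P₀}(∞)`. -/
noncomputable def tUpInf (P : ℝ × ℝ) : ℝ := P.2 + (1 - P.2) * xi0 P.1

/-- `t_{↓,P₀}(s)`, for `0 < s ≤ s₀`: the unique `t` with
`t₀ = t + (1 - t) (1 - s / s₀) ξ₀(s)` (see `eq_tDown_iff`). It may be negative. -/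
noncomputable def tDown (P : ℝ × ℝ) (s : ℝ) : ℝ :=
  (P.2 - (1 - s / P.1) * xi0 s) / (1 - (1 - s / P.1) * xi0 s)

theorem tendsto_tUp (P : ℝ × ℝ) : Tendsto (tUp P) atTop (𝓝 (tUpInf P)) := by
  have h : Tendsto (fun s : ℝ => P.1 / s) atTop (𝓝 0) := tendsto_const_nhds.div_atTop tendsto_id
  have := (((h.const_sub 1).const_mul (1 - P.2)).mul_const (xi0 P.1)).const_add P.2
  simp only [sub_zero, mul_one] at this
  exact this

theorem xi0_mem {s : ℝ} (hs : 0 < s) : 0 ≤ xi0 s ∧ xi0 s ≤ 1 := by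
  have hint : IntervalIntegrable (fun x : ℝ => s * x ^ (s - 1)) MeasureTheory.volume 0 1 :=
    (intervalIntegral.intervalIntegrable_rpow' (by linarith)).const_mul s
  have hval : ∫ x in (0 : ℝ)..1, s * x ^ (s - 1) = 1 := by
    rw [intervalIntegral.integral_const_mul, integral_rpow (Or.inl (by linarith))]
    simp [hs.ne']
  have hcont : ContinuousOn (fun x : ℝ => (1 - x) / (1 + x)) (uIcc 0 1) := by
    rw [uIcc_of_le zero_le_one]
    refine ContinuousOn.div (by fun_prop) (by fun_prop) ?_
    intro x hx
    have := hx.1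
    positivity
  have hint2 := hint.continuousOn_mul hcont
  rw [xi0, if_neg hs.ne']
  constructor
  · refine intervalIntegral.integral_nonneg zero_le_one fun x hx => ?_
    have h1 := hx.1
    have h2 : 0 ≤ 1 - x := by linarith [hx.2]
    positivity
  · refine le_of_le_of_eq ?_ hval
    refine intervalIntegral.integral_mono_on zero_le_one hint2 hint fun x hx => ?_
    have h1 := hx.1
    have h2 : (1 - x) / (1 + x) ≤ 1 := by
      rw [div_le_one (by linarith)]
      linarith
    exact mul_le_of_le_one_left (by positivity) h2

theorem eq_tDown_iff {P : ℝ × ℝ} {s t : ℝ} (hs : 0 < s) (hsP : s ≤ P.1) :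
    t = tDown P s ↔ P.2 = t + (1 - t) * (1 - s / P.1) * xi0 s := by
  have h0 : 0 < P.1 := hs.trans_le hsP
  have h1 : 0 < s / P.1 := by positivity
  have h2 : s / P.1 ≤ 1 := (div_le_one h0).2 hsP
  obtain ⟨h3, h4⟩ := xi0_mem hs
  have hd : 0 < 1 - (1 - s / P.1) * xi0 s := by nlinarith
  rw [tDown, eq_div_iff hd.ne']
  constructor <;> intro h <;> linarith

/-! Write `f = z g` and `u = 1 / s`. The defining condition becomes `Re (g + u z g') ≥ t`, and `s =
∞` becomes `u = 0`. The order is then settled by `diskSet_subset_iff`: for `s > 0` and `t < 1`, the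
set of `(1 / s, t)` lies in that of `(v, t')`, `v ≥ 0`, exactly when `v ≤ 1 / s` and `t'` is at most
the height at `v` of the forward extremal curve of `(s, t)`. Sufficiency: Harnack's inequality
integrated along rays gives `Re g ≥ t + (1 - t) ξ₀(s)`, and `g + v z g'` is a convex combination of
`g` and `g + z g' / s`. Necessity: the extremal function attains the bound in the limit `z → -1`. If
`v > 1 / s`, the coefficient of `Re g` is negative, and the logarithmic growth of the extremal `g`
at `1` defeats every bound.

Hence the common supersets of the pair with `v ≥ 0` are given by `v ≤ 1 / s₂` and `t` below the
minimum of two forward curves; the common subsets with `t < 1` by `0 < s ≤ s₁` and `t` above the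
maximum of two backward curves. The sets on each envelope are pairwise incomparable, because
switching to a new extremal curve midway loses strictly (`forwardCurve_forwardCurve_lt`, resting on
`betaInt_lt`). At the end points `s = s₂` and `s = s₁` the strictness comes from `P₂` lying above
the curve of `P₁`. -/

/-! ### Integral inequalities behind `ξ₀`. -/

/-- The integrand `x ^ s / (1 + x)`, continued to a continuous function on the line. -/
noncomputable def betaKernel (s x : ℝ) : ℝ := x ^ s / (1 + |x|)

/-- The incomplete integral `∫₀¹ x ^ s / (1 + x) dx`. -/
noncomputable def betaInt (s : ℝ) : ℝ := ∫ x in (0 : ℝ)..1, betaKernel s x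

theorem continuous_betaKernel {s : ℝ} (hs : 0 ≤ s) : Continuous (betaKernel s) := by
  unfold betaKernel
  refine (Real.continuous_rpow_const hs).div (by fun_prop) fun x => ?_
  positivity

theorem betaInt_pos {s : ℝ} (hs : 0 ≤ s) : 0 < betaInt s := by
  refine intervalIntegral.intervalIntegral_pos_of_pos_on
    ((continuous_betaKernel hs).intervalIntegrable _ _) (fun x hx => ?_) one_pos
  have := hx.1
  unfold betaKernel
  positivity

theorem betaInt_anti {s r : ℝ} (hs : 0 ≤ s) (hr : s ≤ r) : betaInt r ≤ betaInt s := by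
  refine intervalIntegral.integral_mono_on_of_le_Ioo zero_le_one
    ((continuous_betaKernel (hs.trans hr)).intervalIntegrable _ _)
    ((continuous_betaKernel hs).intervalIntegrable _ _) fun x hx => ?_
  unfold betaKernel
  have := Real.rpow_le_rpow_of_exponent_ge hx.1 hx.2.le hr
  gcongr

theorem betaInt_le_one {s : ℝ} (hs : 0 ≤ s) : betaInt s ≤ 1 := by
  have : betaInt s ≤ ∫ x in (0 : ℝ)..1, (1 : ℝ) := by
    refine intervalIntegral.integral_mono_on_of_le_Ioo zero_le_one
      ((continuous_betaKernel hs).intervalIntegrable _ _) (by simp) fun x hx => ?_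
    unfold betaKernel
    have h1 := Real.rpow_le_one hx.1.le hx.2.le hs
    rw [div_le_one (by positivity)]
    have := abs_nonneg x
    linarith
  simpa using this

theorem xi0_eq {s : ℝ} (hs : 0 < s) : xi0 s = 1 - 2 * s * betaInt s := by
  have hint : IntervalIntegrable (fun x : ℝ => s * x ^ (s - 1)) MeasureTheory.volume 0 1 :=
    (intervalIntegral.intervalIntegrable_rpow' (by linarith)).const_mul s
  have hval : ∫ x in (0 : ℝ)..1, s * x ^ (s - 1) = 1 := by
    rw [intervalIntegral.integral_const_mul, integral_rpow (Or.inl (by linarith))]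
    simp [hs.ne']
  rw [xi0, if_neg hs.ne', betaInt, ← intervalIntegral.integral_const_mul]
  refine Eq.trans ?_ ((intervalIntegral.integral_sub hint
    (((continuous_betaKernel hs.le).const_mul (2 * s)).intervalIntegrable 0 1)).trans
      (by rw [hval]))
  refine intervalIntegral.integral_congr_ae (MeasureTheory.ae_of_all _ fun x hx => ?_)
  rw [uIoc_of_le zero_le_one] at hx
  have h0 := hx.1
  have h1 : x ^ s = x * x ^ (s - 1) := by
    rw [Real.rpow_sub_one h0.ne']
    field_simp
  rw [betaKernel, abs_of_pos h0, h1]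
  field_simp
  ring

theorem xi0_lt_one {s : ℝ} (hs : 0 < s) : xi0 s < 1 := by
  have := betaInt_pos hs.le
  have : 0 < 2 * s * betaInt s := by positivity
  rw [xi0_eq hs]
  linarith

/-- After rescaling to `[0, 1]` the integrands compare pointwise: `1 / (1 + x v) ≤ 2 / ((1 + x) (1 +
v))` amounts to `(1 - x) (1 - v) ≥ 0`. -/
theorem integral_betaKernel_lt {s x : ℝ} (hs : 0 ≤ s) (hx : 0 < x) (hx1 : x < 1) :
    ∫ v in (0 : ℝ)..x, betaKernel s v < 2 * x ^ (s + 1) / (1 + x) * betaInt s := by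
  have hsub : ∫ v in (0 : ℝ)..x, betaKernel s v
      = ∫ v in (0 : ℝ)..1, x * betaKernel s (x * v) := by
    rw [intervalIntegral.integral_const_mul, intervalIntegral.mul_integral_comp_mul_left]
    simp
  have hc := continuous_betaKernel hs
  have key : ∀ v : ℝ, 0 < v → 2 * x ^ (s + 1) / (1 + x) * betaKernel s v
      - x * betaKernel s (x * v)
        = x ^ (s + 1) * v ^ s * ((1 - x) * (1 - v)) / ((1 + x) * (1 + v) * (1 + x * v)) := by
    intro v hv
    rw [betaKernel, betaKernel, abs_of_pos hv, abs_of_pos (mul_pos hx hv),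
      Real.mul_rpow hx.le hv.le, Real.rpow_add_one hx.ne']
    field_simp
    ring
  rw [hsub, betaInt, ← intervalIntegral.integral_const_mul]
  refine intervalIntegral.integral_lt_integral_of_continuousOn_of_le_of_exists_lt one_pos
    (by fun_prop) (by fun_prop) (fun v hv => ?_) ⟨1 / 2, by norm_num, ?_⟩
  · have h0 := hv.1
    have h1 : 0 ≤ 1 - v := by linarith [hv.2]
    have h2 : 0 < 1 - x := by linarith
    rw [← sub_nonneg, key v h0]
    positivity
  · have h2 : 0 < 1 - x := by linarith
    rw [← sub_pos, key _ (by norm_num)]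
    have : (0 : ℝ) < 1 - 1 / 2 := by norm_num
    positivity

/-- This is the strict loss in `forwardCurve_forwardCurve_lt`, stripped of its positive factors.
Replacing the upper limit `1` by `x` gives a function `Ψ` that vanishes at `0`; the constant `c` is
the one for which `integral_betaKernel_lt` makes `Ψ' > 0`. -/
theorem betaInt_lt {s d : ℝ} (hs : 0 ≤ s) (hd : 0 < d) :
    betaInt s < (2 * d * betaInt s + 1) * betaInt (s + d) := by
  have hc := continuous_betaKernel hs
  have hc' := continuous_betaKernel (s := s + d) (by linarith)
  set c := 2 * d * betaInt s + 1 with hcdef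
  let Ψ : ℝ → ℝ := fun x => c * (∫ v in (0 : ℝ)..x, betaKernel (s + d) v)
    - x ^ d * ∫ v in (0 : ℝ)..x, betaKernel s v
  have hI : ∀ x, HasDerivAt (fun x => ∫ v in (0 : ℝ)..x, betaKernel s v) (betaKernel s x) x :=
    fun x => (hc.integral_hasStrictDerivAt 0 x).hasDerivAt
  have hI' : ∀ x, HasDerivAt (fun x => ∫ v in (0 : ℝ)..x, betaKernel (s + d) v)
      (betaKernel (s + d) x) x :=
    fun x => (hc'.integral_hasStrictDerivAt 0 x).hasDerivAt
  have hcont : ContinuousOn Ψ (Icc 0 1) := by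
    have h1 : Continuous (fun x => ∫ v in (0 : ℝ)..x, betaKernel s v) :=
      continuous_iff_continuousAt.2 fun x => (hI x).continuousAt
    have h2 : Continuous (fun x => ∫ v in (0 : ℝ)..x, betaKernel (s + d) v) :=
      continuous_iff_continuousAt.2 fun x => (hI' x).continuousAt
    have h3 : Continuous (fun x : ℝ => x ^ d) := Real.continuous_rpow_const hd.le
    exact ((h2.const_mul c).sub (h3.mul h1)).continuousOn
  have hmono : StrictMonoOn Ψ (Icc 0 1) := by
    refine strictMonoOn_of_deriv_pos (convex_Icc 0 1) hcont fun x hx => ?_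
    rw [interior_Icc] at hx
    obtain ⟨hx0, hx1⟩ := hx
    have hder := ((hI' x).const_mul c).sub
      ((Real.hasDerivAt_rpow_const (x := x) (p := d) (Or.inl hx0.ne')).mul (hI x))
    rw [show deriv Ψ x = _ from hder.deriv]
    have hlt := integral_betaKernel_lt hs hx0 hx1
    have hp : 0 < d * x ^ (d - 1) := by positivity
    have e1 : x ^ (s + d) = x ^ d * x ^ s := by rw [add_comm, Real.rpow_add hx0]
    have e2 : x ^ d = x ^ (d - 1) * x := by rw [Real.rpow_sub_one hx0.ne']; field_simp
    have e3 : x ^ (s + 1) = x ^ s * x := Real.rpow_add_one hx0.ne' s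
    rw [e3] at hlt
    have := mul_lt_mul_of_pos_left hlt hp
    rw [betaKernel, betaKernel, abs_of_pos hx0, e1, hcdef]
    have e4 : (2 * d * betaInt s + 1) * (x ^ d * x ^ s / (1 + x))
      = d * x ^ (d - 1) * (2 * (x ^ s * x) / (1 + x) * betaInt s) + x ^ d * (x ^ s / (1 + x)) := by
      rw [e2]; ring
    rw [e4]
    linarith
  have := hmono (left_mem_Icc.2 zero_le_one) (right_mem_Icc.2 zero_le_one) one_pos
  simp only [Ψ, intervalIntegral.integral_same, mul_zero, sub_zero, Real.one_rpow, one_mul] at this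
  exact sub_pos.1 this

/-- Right continuity suffices later: `betaInt_lt` and `betaInt_le_one` give `betaInt r ≥ betaInt s -
2 (r - s)`, and monotonicity gives the other side. -/
theorem tendsto_xi0_nhdsGT {s : ℝ} (hs : 0 < s) : Tendsto xi0 (𝓝[>] s) (𝓝 (xi0 s)) := by
  have hid : Tendsto (fun r : ℝ => r) (𝓝[>] s) (𝓝 s) :=
    tendsto_nhdsWithin_of_tendsto_nhds tendsto_id
  have hb : Tendsto betaInt (𝓝[>] s) (𝓝 (betaInt s)) := by
    have hlow : Tendsto (fun r => betaInt s - 2 * (r - s)) (𝓝[>] s) (𝓝 (betaInt s)) := by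
      have := ((hid.sub_const s).const_mul 2).const_sub (betaInt s)
      simpa using this
    refine tendsto_of_tendsto_of_tendsto_of_le_of_le' hlow tendsto_const_nhds ?_ ?_
    · filter_upwards [self_mem_nhdsWithin] with r hr
      have hr : s < r := hr
      have h := betaInt_lt hs.le (sub_pos.2 hr)
      rw [add_sub_cancel] at h
      have h1 := betaInt_le_one hs.le
      have h2 := betaInt_le_one (hs.trans hr).le
      have h3 := betaInt_pos hs.le
      have h4 := betaInt_pos (hs.trans hr).le
      have h5 : betaInt s * betaInt r ≤ 1 := by nlinarith
      nlinarith
    · filter_upwards [self_mem_nhdsWithin] with r hr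
      exact betaInt_anti hs.le (le_of_lt hr)
  rw [xi0_eq hs]
  refine (((hid.const_mul 2).mul hb).const_sub 1).congr' ?_
  filter_upwards [self_mem_nhdsWithin] with r hr
  rw [xi0_eq (hs.trans hr)]

/-! ### Forward extremal curves. -/

/-- The forward extremal curve of the point `(s, t)`, as a function of `v = 1 / s'`, so that `v = 0`
corresponds to `s' = ∞`. -/
noncomputable def forwardCurve (s t v : ℝ) : ℝ := t + (1 - t) * (1 - s * v) * xi0 s

theorem one_sub_forwardCurve (s t v : ℝ) :
    1 - forwardCurve s t v = (1 - t) * (1 - (1 - s * v) * xi0 s) := by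
  unfold forwardCurve; ring

theorem one_sub_mul_xi0_pos {s v : ℝ} (hs : 0 < s) (hv : 0 ≤ v) :
    0 < 1 - (1 - s * v) * xi0 s := by
  have h1 := xi0_mem hs
  have h2 := xi0_lt_one hs
  nlinarith [mul_nonneg hs.le hv, mul_nonneg (mul_nonneg hs.le hv) h1.1]

theorem forwardCurve_lt_one {s t v : ℝ} (hs : 0 < s) (ht : t < 1) (hv : 0 ≤ v) :
    forwardCurve s t v < 1 := by
  have := mul_pos (sub_pos.2 ht) (one_sub_mul_xi0_pos hs hv)
  rw [← one_sub_forwardCurve] at this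
  linarith

theorem forwardCurve_strictMono {s v : ℝ} (hs : 0 < s) (hv : 0 ≤ v) :
    StrictMono fun t => forwardCurve s t v := by
  intro t t' h
  have := mul_lt_mul_of_pos_right h (one_sub_mul_xi0_pos hs hv)
  simp only [forwardCurve]
  linarith

theorem le_forwardCurve {s t v : ℝ} (hs : 0 < s) (ht : t ≤ 1) (hv : v ≤ s⁻¹) :
    t ≤ forwardCurve s t v := by
  have h1 : s * v ≤ 1 := by
    have := mul_le_mul_of_nonneg_left hv hs.le
    rwa [mul_inv_cancel₀ hs.ne'] at this
  have := mul_nonneg (mul_nonneg (sub_nonneg.2 ht) (sub_nonneg.2 h1)) (xi0_mem hs).1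
  unfold forwardCurve
  linarith

/-- Following the extremal curve of `(s, t)` up to `s'` and then the one of the point reached
is strictly worse than staying on the first one. -/
theorem forwardCurve_forwardCurve_lt {s s' t v : ℝ} (hs : 0 < s) (hss' : s < s') (ht : t < 1)
    (hv : v < s'⁻¹) :
    forwardCurve s' (forwardCurve s t s'⁻¹) v < forwardCurve s t v := by
  have hs' := hs.trans hss'
  have hb := betaInt_lt hs.le (sub_pos.2 hss')
  rw [add_sub_cancel] at hb
  have hxs := xi0_eq hs
  have hxs' := xi0_eq hs'
  have hv1 : 0 < 1 - s' * v := by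
    have := mul_lt_mul_of_pos_left hv hs'
    rw [mul_inv_cancel₀ hs'.ne'] at this
    linarith
  -- The difference factors exactly, with the gap of `betaInt_lt` for `d = s' - s` as the last
  -- factor.
  have key : (1 - forwardCurve s' (forwardCurve s t s'⁻¹) v) - (1 - forwardCurve s t v)
      = (1 - t) * (1 - s' * v) *
        (2 * s * ((2 * (s' - s) * betaInt s + 1) * betaInt s' - betaInt s)) := by
    rw [one_sub_forwardCurve, one_sub_forwardCurve, one_sub_forwardCurve, hxs, hxs']
    field_simp
    ring
  have : 0 < (1 - t) * (1 - s' * v) *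
        (2 * s * ((2 * (s' - s) * betaInt s + 1) * betaInt s' - betaInt s)) :=
    mul_pos (mul_pos (sub_pos.2 ht) hv1) (mul_pos (by positivity) (sub_pos.2 hb))
  linarith

/-! ### Functions with real part bounded below. -/

/-- The Schwarz lemma for functions with nonnegative real part, normalized by `q 0 = 1`. -/
theorem norm_one_sub_le_of_re_nonneg {q : ℂ → ℂ} (hq : DifferentiableOn ℂ q (ball 0 1))
    (hq0 : q 0 = 1) (hre : ∀ z ∈ ball (0 : ℂ) 1, 0 ≤ (q z).re) {z : ℂ} (hz : z ∈ ball (0 : ℂ) 1) :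
    ‖1 - q z‖ ≤ ‖z‖ * ‖1 + q z‖ := by
  have hne : ∀ w ∈ ball (0 : ℂ) 1, 1 + q w ≠ 0 := by
    intro w hw h
    have := congrArg Complex.re h
    simp only [Complex.add_re, Complex.one_re, Complex.zero_re] at this
    linarith [hre w hw]
  -- The Cayley transform takes the right half-plane to the unit disk and `1` to `0`.
  let φ : ℂ → ℂ := fun w => (1 - q w) / (1 + q w)
  have hφ0 : φ 0 = 0 := by simp [φ, hq0]
  have hφ : DifferentiableOn ℂ φ (ball 0 1) := (hq.const_sub 1).div (hq.const_add 1) hne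
  have hmaps : MapsTo φ (ball 0 1) (closedBall (φ 0) 1) := by
    intro w hw
    rw [hφ0, mem_closedBall_zero_iff, norm_div, div_le_one (norm_pos_iff.2 (hne w hw))]
    rw [← sq_le_sq₀ (norm_nonneg _) (norm_nonneg _), Complex.sq_norm, Complex.sq_norm,
      Complex.normSq_apply, Complex.normSq_apply]
    simp only [Complex.add_re, Complex.sub_re, Complex.one_re, Complex.add_im, Complex.sub_im,
      Complex.one_im]
    nlinarith [hre w hw]
  have := Complex.dist_le_div_mul_dist_of_mapsTo_ball hφ hmaps hz
  rw [hφ0, dist_zero_right, dist_zero_right, norm_div, div_one, one_mul,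
    div_le_iff₀ (norm_pos_iff.2 (hne z hz))] at this
  exact this

/-- Harnack's inequality on the unit disk, lower bound. -/
theorem harnack_re {q : ℂ → ℂ} (hq : DifferentiableOn ℂ q (ball 0 1))
    (hq0 : q 0 = 1) (hre : ∀ z ∈ ball (0 : ℂ) 1, 0 ≤ (q z).re) {z : ℂ} (hz : z ∈ ball (0 : ℂ) 1) :
    (1 - ‖z‖) / (1 + ‖z‖) ≤ (q z).re := by
  have h := norm_one_sub_le_of_re_nonneg hq hq0 hre hz
  have ha := hre z hz
  have hr : ‖z‖ < 1 := mem_ball_zero_iff.1 hz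
  have hr0 := norm_nonneg z
  rw [← sq_le_sq₀ (norm_nonneg _) (by positivity), mul_pow, Complex.sq_norm (1 - q z),
    Complex.sq_norm (1 + q z), Complex.normSq_apply, Complex.normSq_apply] at h
  simp only [Complex.add_re, Complex.sub_re, Complex.one_re, Complex.add_im, Complex.sub_im,
    Complex.one_im] at h
  have hr2 : 0 ≤ 1 - ‖z‖ ^ 2 := by nlinarith
  -- The imaginary part enters as `(1 - ‖z‖²) (Im q)² ≥ 0` and can be dropped.
  have h2 : (1 - (q z).re) ^ 2 ≤ (‖z‖ * (1 + (q z).re)) ^ 2 := by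
    nlinarith [mul_nonneg hr2 (sq_nonneg (q z).im)]
  have h3 := le_of_sq_le_sq h2 (by positivity)
  rw [div_le_iff₀ (by positivity)]
  nlinarith

/-- A holomorphic function whose real part has a minimum at the origin is constant. -/
theorem eq_one_of_one_le_re {p : ℂ → ℂ} (hp : DifferentiableOn ℂ p (ball 0 1))
    (hp0 : p 0 = 1) (hre : ∀ z ∈ ball (0 : ℂ) 1, 1 ≤ (p z).re) {z : ℂ} (hz : z ∈ ball (0 : ℂ) 1) :
    p z = 1 := by
  have hr : ‖z‖ < 1 := mem_ball_zero_iff.1 hz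
  -- Since `Re (p - 1) ≥ 0`, the Schwarz bound applies to `1 + n (p - 1)` for every `n`; large `n`
  -- forces `p z = 1`.
  have key : ∀ n : ℕ, n * (‖p z - 1‖ * (1 - ‖z‖)) ≤ 2 * ‖z‖ := by
    intro n
    have := norm_one_sub_le_of_re_nonneg (q := fun w => 1 + n * (p w - 1))
      (((hp.sub_const 1).const_mul (n : ℂ)).const_add 1) (by simp [hp0]) (fun w hw => by
        have h1 : 0 ≤ (p w).re - 1 := sub_nonneg.2 (hre w hw)
        have : 0 ≤ (n : ℝ) * ((p w).re - 1) := by positivity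
        simp only [Complex.add_re, Complex.one_re, Complex.mul_re, Complex.natCast_re,
          Complex.natCast_im, Complex.sub_re, zero_mul, sub_zero]
        linarith) hz
    have e1 : ‖1 - (1 + n * (p z - 1))‖ = n * ‖p z - 1‖ := by
      rw [sub_add_cancel_left, norm_neg, norm_mul, Complex.norm_natCast]
    have e2 : ‖1 + (1 + n * (p z - 1))‖ ≤ 2 + n * ‖p z - 1‖ := by
      rw [← add_assoc]
      refine (norm_add_le _ _).trans ?_
      rw [norm_mul, Complex.norm_natCast]
      norm_num
    rw [e1] at this
    nlinarith [mul_le_mul_of_nonneg_left e2 (norm_nonneg z)]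
  by_contra hne
  have hpos : 0 < ‖p z - 1‖ * (1 - ‖z‖) :=
    mul_pos (norm_pos_iff.2 (sub_ne_zero.2 hne)) (by linarith)
  obtain ⟨n, hn⟩ := exists_nat_gt (2 * ‖z‖ / (‖p z - 1‖ * (1 - ‖z‖)))
  rw [div_lt_iff₀ hpos] at hn
  linarith [key n]

/-! ### Integration of Harnack's bound along rays. -/

theorem hasDerivAt_re_ray {g : ℂ → ℂ} (hg : DifferentiableOn ℂ g (ball 0 1)) {z : ℂ} {x : ℝ}
    (hx : (x : ℂ) * z ∈ ball (0 : ℂ) 1) :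
    HasDerivAt (fun x : ℝ => (g (x * z)).re) (z * deriv g (x * z)).re x := by
  have h1 := (hg.differentiableAt (isOpen_ball.mem_nhds hx)).hasDerivAt
  have h2 : HasDerivAt (fun w : ℂ => w * z) z (x : ℂ) := by
    simpa using (hasDerivAt_id (x : ℂ)).mul_const z
  have h3 := (HasDerivAt.comp (x : ℂ) h1 h2).real_of_complex
  rw [mul_comm z]
  exact h3

theorem ofReal_mul_mem_ball {z : ℂ} (hz : z ∈ ball (0 : ℂ) 1) {x : ℝ} (hx : x ∈ Icc (0 : ℝ) 1) :
    (x : ℂ) * z ∈ ball (0 : ℂ) 1 := by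
  rw [mem_ball_zero_iff] at *
  rw [norm_mul, Complex.norm_real, Real.norm_of_nonneg hx.1]
  nlinarith [norm_nonneg z, hx.2]

theorem harnack_re_of_le {p : ℂ → ℂ} {t : ℝ} (ht : t < 1) (hp : DifferentiableOn ℂ p (ball 0 1))
    (hp0 : p 0 = 1) (hre : ∀ z ∈ ball (0 : ℂ) 1, t ≤ (p z).re) {z : ℂ} (hz : z ∈ ball (0 : ℂ) 1) :
    t + (1 - t) * ((1 - ‖z‖) / (1 + ‖z‖)) ≤ (p z).re := by
  have ht' : 0 < 1 - t := sub_pos.2 ht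
  have hre' : ∀ w : ℂ, (((1 - t)⁻¹ : ℝ) * (p w - t) : ℂ).re = (1 - t)⁻¹ * ((p w).re - t) := by
    intro w
    rw [Complex.re_ofReal_mul, Complex.sub_re, Complex.ofReal_re]
  have h := harnack_re (q := fun w => ((1 - t)⁻¹ : ℝ) * (p w - t))
    ((hp.sub_const _).const_mul _) (by
      rw [hp0]
      push_cast
      refine inv_mul_cancel₀ ?_
      exact_mod_cast ht'.ne') (fun w hw => by
        rw [hre']
        have := sub_nonneg.2 (hre w hw)
        positivity) hz
  rw [hre', inv_mul_eq_div, le_div_iff₀ ht'] at h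
  linarith

theorem hasDerivAt_rpow_mul_re_ray {g : ℂ → ℂ} (hg : DifferentiableOn ℂ g (ball 0 1)) {s x : ℝ}
    {z : ℂ} (hs : s ≠ 0) (hx0 : 0 < x) (hx : (x : ℂ) * z ∈ ball (0 : ℂ) 1) :
    HasDerivAt (fun x : ℝ => x ^ s * (g (x * z)).re)
      (s * x ^ (s - 1) * (g (x * z) + (s⁻¹ : ℝ) * (x * z * deriv g (x * z))).re) x := by
  convert! (Real.hasDerivAt_rpow_const (p := s) (Or.inl hx0.ne')).mul (hasDerivAt_re_ray hg hx)
    using 1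
  have e1 : x ^ s = x ^ (s - 1) * x := by rw [Real.rpow_sub_one hx0.ne']; field_simp
  rw [Complex.add_re, Complex.re_ofReal_mul, mul_assoc (x : ℂ), Complex.re_ofReal_mul, e1]
  field_simp

/-- If `Re (g + z g' / s) ≥ t` then `Re g ≥ t + (1 - t) ξ₀(s)`. -/
theorem le_re_of_le_re_add {g : ℂ → ℂ} {s t : ℝ} (hs : 0 < s) (ht : t < 1)
    (hg : DifferentiableOn ℂ g (ball 0 1)) (hg0 : g 0 = 1)
    (hre : ∀ z ∈ ball (0 : ℂ) 1, z ≠ 0 → t ≤ (g z + (s⁻¹ : ℝ) * (z * deriv g z)).re)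
    {z : ℂ} (hz : z ∈ ball (0 : ℂ) 1) : t + (1 - t) * xi0 s ≤ (g z).re := by
  have hp : DifferentiableOn ℂ (fun z => g z + (s⁻¹ : ℝ) * (z * deriv g z)) (ball 0 1) :=
    hg.add ((differentiableOn_id.mul (hg.deriv isOpen_ball)).const_mul _)
  have hre' : ∀ z ∈ ball (0 : ℂ) 1, t ≤ (g z + (s⁻¹ : ℝ) * (z * deriv g z)).re := by
    intro w hw
    rcases eq_or_ne w 0 with rfl | h
    · simp [hg0, ht.le]
    · exact hre w hw h
  have hc := continuous_betaKernel hs.le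
  -- The derivative of `x ^ s * Re g(xz)` is `s x ^ (s - 1)` times the real part bounded by Harnack.
  -- The subtracted term is the primitive of that bound, so `D` increases from `D 0 = 0`, and `D 1 ≥
  -- 0` is the claim.
  let D : ℝ → ℝ := fun x => x ^ s * (g (x * z)).re -
    (x ^ s - (1 - t) * (2 * s * ∫ v in (0 : ℝ)..x, betaKernel s v))
  have hI : ∀ x, HasDerivAt (fun x => ∫ v in (0 : ℝ)..x, betaKernel s v) (betaKernel s x) x :=
    fun x => (hc.integral_hasStrictDerivAt 0 x).hasDerivAt
  have hcont : ContinuousOn D (Icc 0 1) := by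
    have h1 : Continuous (fun x => ∫ v in (0 : ℝ)..x, betaKernel s v) :=
      continuous_iff_continuousAt.2 fun x => (hI x).continuousAt
    have h3 : Continuous (fun x : ℝ => x ^ s) := Real.continuous_rpow_const hs.le
    refine (h3.continuousOn.mul fun x hx => ?_).sub
      (h3.sub ((h1.const_mul _).const_mul _)).continuousOn
    exact (hasDerivAt_re_ray hg (ofReal_mul_mem_ball hz hx)).continuousAt.continuousWithinAt
  have hmono : MonotoneOn D (Icc 0 1) := by
    have hder : ∀ x ∈ Ioo (0 : ℝ) 1, HasDerivAt D (s * x ^ (s - 1) *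
        (g (x * z) + (s⁻¹ : ℝ) * (x * z * deriv g (x * z))).re - (s * x ^ (s - 1) -
          (1 - t) * (2 * s * betaKernel s x))) x := by
      intro x hx
      have hpow := Real.hasDerivAt_rpow_const (x := x) (p := s) (Or.inl hx.1.ne')
      exact (hasDerivAt_rpow_mul_re_ray hg hs.ne' hx.1
        (ofReal_mul_mem_ball hz (Ioo_subset_Icc_self hx))).sub
        (hpow.sub (((hI x).const_mul _).const_mul _))
    refine monotoneOn_of_deriv_nonneg (convex_Icc 0 1) hcont ?_ ?_ <;> rw [interior_Icc]
    · exact fun x hx => (hder x hx).differentiableAt.differentiableWithinAt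
    · intro x hx
      rw [(hder x hx).deriv]
      obtain ⟨hx0, hx1⟩ := hx
      have hxz := ofReal_mul_mem_ball hz ⟨hx0.le, hx1.le⟩
      have h := harnack_re_of_le ht hp (by simp [hg0]) hre' hxz
      have hn : ‖(x : ℂ) * z‖ ≤ x := by
        rw [norm_mul, Complex.norm_real, Real.norm_of_nonneg hx0.le]
        nlinarith [mem_ball_zero_iff.1 hz]
      have h1 : (1 - x) / (1 + x) ≤ (1 - ‖(x : ℂ) * z‖) / (1 + ‖(x : ℂ) * z‖) := by
        have := norm_nonneg ((x : ℂ) * z)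
        rw [div_le_div_iff₀ (by positivity) (by positivity)]
        nlinarith
      have h2 := h.trans' (add_le_add_right (mul_le_mul_of_nonneg_left h1 (sub_pos.2 ht).le) t)
      have e1 : x ^ s = x ^ (s - 1) * x := by rw [Real.rpow_sub_one hx0.ne']; field_simp
      have h3 : 0 < s * x ^ (s - 1) := by positivity
      have h4 := mul_le_mul_of_nonneg_left h2 h3.le
      have e4 : s * x ^ (s - 1) * (t + (1 - t) * ((1 - x) / (1 + x)))
          = s * x ^ (s - 1) - (1 - t) * (2 * s * betaKernel s x) := by
        rw [betaKernel, abs_of_pos hx0, e1]; field_simp; ring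
      rw [e4] at h4
      linarith
  have := hmono (left_mem_Icc.2 zero_le_one) (right_mem_Icc.2 zero_le_one) zero_le_one
  simp only [D, Real.zero_rpow hs.ne', intervalIntegral.integral_same, Real.one_rpow,
    Complex.ofReal_one, one_mul, zero_mul, mul_zero, sub_zero] at this
  rw [xi0_eq hs]
  unfold betaInt
  linarith

/-! ### The sets in the parameter `u = 1 / s`, and the sufficient condition for inclusion. -/

/-- The sets `setA s t` and `setAInf t` in the common parameter `u = 1 / s ∈ [0, ∞)`. -/
def diskSet (u t : ℝ) : Set (ℂ → ℂ) :=
  {f | f ∈ NormalizedHol ∧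
    ∀ z ∈ ball (0 : ℂ) 1, z ≠ 0 → t ≤ (f z / z + u * (deriv f z - f z / z)).re}

theorem setAInf_eq_diskSet (t : ℝ) : setAInf t = diskSet 0 t := by
  simp [setAInf, diskSet]

theorem setA_eq_diskSet {s : ℝ} (hs : 0 < s) (t : ℝ) : setA s t = diskSet s⁻¹ t := by
  ext f
  refine and_congr_right fun _ => forall₃_congr fun z _ _ => ?_
  have : (((s : ℂ) - 1) * (f z / z) + deriv f z)
      = (s : ℂ) * (f z / z + (s⁻¹ : ℝ) * (deriv f z - f z / z)) := by
    have : (s : ℂ) ≠ 0 := by exact_mod_cast hs.ne'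
    push_cast
    field_simp
    ring
  rw [this, Complex.re_ofReal_mul, mul_le_mul_iff_right₀ hs]

theorem deriv_mul_self {g : ℂ → ℂ} (hg : DifferentiableOn ℂ g (ball 0 1)) {z : ℂ}
    (hz : z ∈ ball (0 : ℂ) 1) : deriv (fun z => z * g z) z = g z + z * deriv g z := by
  have := ((hasDerivAt_id z).mul
    (hg.differentiableAt (isOpen_ball.mem_nhds hz)).hasDerivAt).deriv
  rw [one_mul] at this
  exact this

theorem exists_quotient {f : ℂ → ℂ} (hf : f ∈ NormalizedHol) :
    ∃ g : ℂ → ℂ, DifferentiableOn ℂ g (ball 0 1) ∧ g 0 = 1 ∧ f = (fun z => z * g z) ∧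
      ∀ z ∈ ball (0 : ℂ) 1, deriv f z = g z + z * deriv g z := by
  obtain ⟨hd, h0, h1⟩ := hf
  have hg := (Complex.differentiableOn_dslope (ball_mem_nhds (0 : ℂ) one_pos)).2 hd
  have hfg : f = fun z => z * dslope f 0 z := by
    ext z
    have := sub_smul_dslope f 0 z
    simp only [sub_zero, h0, smul_eq_mul] at this
    exact this.symm
  refine ⟨dslope f 0, hg, by rw [dslope_same, h1], hfg, fun z hz => ?_⟩
  exact (congrArg (fun F => deriv F z) hfg).trans (deriv_mul_self hg hz)

theorem mul_mem_normalizedHol {g : ℂ → ℂ} (hg : DifferentiableOn ℂ g (ball 0 1)) (hg0 : g 0 = 1) :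
    (fun z => z * g z) ∈ NormalizedHol := by
  refine ⟨differentiableOn_id.mul hg, by simp, ?_⟩
  have := ((hasDerivAt_id (0 : ℂ)).mul
    (hg.differentiableAt (isOpen_ball.mem_nhds (mem_ball_self one_pos))).hasDerivAt).deriv
  simp only [id, one_mul, zero_mul, add_zero, hg0] at this
  exact this

theorem mul_mem_diskSet_iff {g : ℂ → ℂ} (hg : DifferentiableOn ℂ g (ball 0 1)) (hg0 : g 0 = 1)
    {u t : ℝ} : (fun z => z * g z) ∈ diskSet u t ↔
      ∀ z ∈ ball (0 : ℂ) 1, z ≠ 0 → t ≤ (g z + u * (z * deriv g z)).re := by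
  refine (and_iff_right (mul_mem_normalizedHol hg hg0)).trans
    (forall₃_congr fun z hz hz0 => ?_)
  rw [deriv_mul_self hg hz, mul_div_cancel_left₀ _ hz0, add_sub_cancel_left]

theorem diskSet_anti (u : ℝ) {t t' : ℝ} (h : t ≤ t') : diskSet u t' ⊆ diskSet u t :=
  fun _ hf => ⟨hf.1, fun z hz hz0 => h.trans (hf.2 z hz hz0)⟩

theorem exists_quotient_of_mem_diskSet {f : ℂ → ℂ} {u t : ℝ} (hf : f ∈ diskSet u t) :
    ∃ g : ℂ → ℂ, DifferentiableOn ℂ g (ball 0 1) ∧ g 0 = 1 ∧ f = (fun z => z * g z) ∧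
      ∀ z ∈ ball (0 : ℂ) 1, z ≠ 0 → t ≤ (g z + u * (z * deriv g z)).re := by
  obtain ⟨g, hg, hg0, rfl, -⟩ := exists_quotient hf.1
  exact ⟨g, hg, hg0, rfl, (mul_mem_diskSet_iff hg hg0).1 hf⟩

/-- `g + v z g' = (1 - s v) g + s v (g + z g' / s)` with both weights nonnegative. The summands have
real parts at least `t + (1 - t) ξ₀(s)` and `t`, and the weighted sum of these is the forward curve.
-/
theorem diskSet_subset_of_le_forwardCurve {s t v t' : ℝ} (hs : 0 < s) (ht : t < 1) (hv : 0 ≤ v)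
    (hvs : v ≤ s⁻¹) (h : t' ≤ forwardCurve s t v) : diskSet s⁻¹ t ⊆ diskSet v t' := by
  intro f hf
  obtain ⟨g, hg, hg0, rfl, hre⟩ := exists_quotient_of_mem_diskSet hf
  refine (mul_mem_diskSet_iff hg hg0).2 fun z hz hz0 => h.trans ?_
  have h1 := le_re_of_le_re_add hs ht hg hg0 hre hz
  have h2 := hre z hz hz0
  have hsv : s * v ≤ 1 := by
    have := mul_le_mul_of_nonneg_left hvs hs.le
    rwa [mul_inv_cancel₀ hs.ne'] at this
  simp only [Complex.add_re, Complex.re_ofReal_mul] at h2 ⊢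
  have h3 := mul_le_mul_of_nonneg_left h1 (sub_nonneg.2 hsv)
  have h4 := mul_le_mul_of_nonneg_left h2 (mul_nonneg hs.le hv)
  have e : s * v * ((g z).re + s⁻¹ * (z * deriv g z).re)
      = s * v * (g z).re + v * (z * deriv g z).re := by field_simp
  rw [e] at h4
  unfold forwardCurve
  linarith

/-- Functions that agree with the identity on the disk: the smallest set of the family. -/
def identitySet : Set (ℂ → ℂ) := {f | ∀ z ∈ ball (0 : ℂ) 1, f z = z}

theorem identitySet_subset_normalizedHol {f : ℂ → ℂ} (hf : f ∈ identitySet) :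
    f ∈ NormalizedHol ∧ ∀ z ∈ ball (0 : ℂ) 1, deriv f z = 1 := by
  have hd : ∀ z ∈ ball (0 : ℂ) 1, HasDerivAt f 1 z := fun z hz =>
    (hasDerivAt_id z).congr_of_eventuallyEq
      (Filter.eventually_of_mem (isOpen_ball.mem_nhds hz) hf)
  have h0 : (0 : ℂ) ∈ ball (0 : ℂ) 1 := mem_ball_self one_pos
  exact ⟨⟨fun z hz => (hd z hz).differentiableAt.differentiableWithinAt, hf 0 h0,
    (hd 0 h0).deriv⟩, fun z hz => (hd z hz).deriv⟩

theorem identitySet_subset_diskSet (u : ℝ) {t : ℝ} (ht : t ≤ 1) : identitySet ⊆ diskSet u t := by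
  intro f hf
  obtain ⟨h1, h2⟩ := identitySet_subset_normalizedHol hf
  refine ⟨h1, fun z hz hz0 => ?_⟩
  rw [hf z hz, h2 z hz, div_self hz0]
  simpa using ht

theorem mem_identitySet_of_one_le_re {g : ℂ → ℂ} (hg : DifferentiableOn ℂ g (ball 0 1))
    (hg0 : g 0 = 1) (h : ∀ z ∈ ball (0 : ℂ) 1, 1 ≤ (g z).re) :
    (fun z => z * g z) ∈ identitySet := fun z hz => by
  simp only [eq_one_of_one_le_re hg hg0 h hz, mul_one]

theorem diskSet_one {u : ℝ} (hu : 0 ≤ u) : diskSet u 1 = identitySet := by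
  refine Subset.antisymm (fun f hf => ?_) (identitySet_subset_diskSet u le_rfl)
  obtain ⟨g, hg, hg0, rfl, hre⟩ := exists_quotient_of_mem_diskSet hf
  refine mem_identitySet_of_one_le_re hg hg0 fun z hz => ?_
  rcases hu.eq_or_lt with rfl | hu
  · rcases eq_or_ne z 0 with rfl | hz0
    · simp [hg0]
    · simpa using hre z hz hz0
  -- The ray estimate needs a level below `1`, so level `1` is approached from below.
  · refine le_of_forall_lt_imp_le_of_dense fun t ht => ?_
    have hre' := fun w hw hw0 => ht.le.trans (hre w hw hw0)
    rw [← inv_inv u] at hre'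
    have := le_re_of_le_re_add (inv_pos.2 hu) ht hg hg0 hre' hz
    nlinarith [(xi0_mem (inv_pos.2 hu)).1]

/-- For `s = 0` the condition reads `Re (z g') ≥ 0`, so `Re g` increases along rays from `g 0 = 1`,
and the minimum principle makes `g` constant. -/
theorem setA_zero (t : ℝ) : setA 0 t = identitySet := by
  refine Subset.antisymm (fun f hf => ?_) (fun f hf => ?_)
  · obtain ⟨g, hg, hg0, rfl, hder⟩ := exists_quotient hf.1
    refine mem_identitySet_of_one_le_re hg hg0 fun z hz => ?_
    have hmono : MonotoneOn (fun x : ℝ => (g (x * z)).re) (Icc 0 1) := by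
      have hd : ∀ x ∈ Icc (0 : ℝ) 1, _ := fun x hx =>
        hasDerivAt_re_ray hg (ofReal_mul_mem_ball hz hx)
      refine monotoneOn_of_deriv_nonneg (convex_Icc 0 1)
        (fun x hx => (hd x hx).continuousAt.continuousWithinAt) ?_ ?_ <;> rw [interior_Icc]
      · exact fun x hx => (hd x (Ioo_subset_Icc_self hx)).differentiableAt.differentiableWithinAt
      · intro x hx
        rw [(hd x (Ioo_subset_Icc_self hx)).deriv]
        rcases eq_or_ne z 0 with rfl | hz0
        · simp
        have hxz := ofReal_mul_mem_ball hz (Ioo_subset_Icc_self hx)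
        have hx0 : (x : ℂ) * z ≠ 0 := mul_ne_zero (by exact_mod_cast hx.1.ne') hz0
        have h := hf.2 _ hxz hx0
        rw [hder _ hxz] at h
        simp only [mul_div_cancel_left₀ _ hx0, Complex.ofReal_zero] at h
        have e : (0 - 1 : ℂ) * g (x * z) + (g (x * z) + x * z * deriv g (x * z))
          = x * (z * deriv g (x * z)) := by ring
        rw [e, Complex.re_ofReal_mul, zero_mul] at h
        exact nonneg_of_mul_nonneg_right h hx.1
    have := hmono (left_mem_Icc.2 zero_le_one) (right_mem_Icc.2 zero_le_one) zero_le_one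
    simpa [hg0] using this
  · obtain ⟨h1, h2⟩ := identitySet_subset_normalizedHol hf
    refine ⟨h1, fun z hz hz0 => ?_⟩
    rw [hf z hz, h2 z hz, div_self hz0]
    simp

/-! ### Extremal functions and sharpness on the negative axis. -/

/-- The power series `∑ zⁿ / (1 + u n)`, which solves `k + u z k' = 1 / (1 - z)`. -/
noncomputable def weightedGeom (u : ℝ) (z : ℂ) : ℂ := ∑' n : ℕ, z ^ n / ((1 + u * n : ℝ) : ℂ)

theorem norm_weightedGeom_term_le {u : ℝ} (hu : 0 ≤ u) (z : ℂ) (n : ℕ) :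
    ‖z ^ n / ((1 + u * n : ℝ) : ℂ)‖ ≤ ‖z‖ ^ n := by
  have : 0 ≤ u * n := by positivity
  rw [norm_div, norm_pow, Complex.norm_real, Real.norm_of_nonneg (by positivity)]
  exact div_le_self (by positivity) (by linarith)

theorem hasSum_weightedGeom {u : ℝ} (hu : 0 ≤ u) {z : ℂ} (hz : z ∈ ball (0 : ℂ) 1) :
    HasSum (fun n : ℕ => z ^ n / ((1 + u * n : ℝ) : ℂ)) (weightedGeom u z) :=
  (Summable.of_norm_bounded (summable_geometric_of_lt_one (norm_nonneg z)
    (mem_ball_zero_iff.1 hz)) (norm_weightedGeom_term_le hu z)).hasSum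

theorem weightedGeom_zero (u : ℝ) : weightedGeom u 0 = 1 := by
  rw [weightedGeom, tsum_eq_single 0]
  · simp
  · intro n hn
    simp [hn]

theorem differentiableOn_weightedGeom_term (u : ℝ) (n : ℕ) (U : Set ℂ) :
    DifferentiableOn ℂ (fun z : ℂ => z ^ n / ((1 + u * n : ℝ) : ℂ)) U := by fun_prop

theorem weightedGeom_spec {u : ℝ} (hu : 0 ≤ u) {z : ℂ} (hz : z ∈ ball (0 : ℂ) 1) :
    DifferentiableAt ℂ (weightedGeom u) z ∧
      weightedGeom u z + u * (z * deriv (weightedGeom u) z) = (1 - z)⁻¹ := by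
  have hz1 := mem_ball_zero_iff.1 hz
  obtain ⟨r, hzr, hr⟩ := exists_between hz1
  have hr0 : 0 ≤ r := (norm_nonneg z).trans hzr.le
  have hzr' : z ∈ ball (0 : ℂ) r := mem_ball_zero_iff.2 hzr
  have hsum := summable_geometric_of_lt_one hr0 hr
  have hle : ∀ (n : ℕ) (w : ℂ), w ∈ ball (0 : ℂ) r → ‖w ^ n / ((1 + u * n : ℝ) : ℂ)‖ ≤ r ^ n :=
    fun n w hw => (norm_weightedGeom_term_le hu w n).trans
      (pow_le_pow_left₀ (norm_nonneg w) (mem_ball_zero_iff.1 hw).le n)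
  have hdiff : DifferentiableOn ℂ (weightedGeom u) (ball 0 r) :=
    Complex.differentiableOn_tsum_of_summable_norm hsum
      (fun n => differentiableOn_weightedGeom_term u n _) isOpen_ball hle
  refine ⟨hdiff.differentiableAt (isOpen_ball.mem_nhds hzr'), ?_⟩
  have hd : HasSum _ (deriv (weightedGeom u) z) :=
    Complex.hasSum_deriv_of_summable_norm hsum
      (fun n => differentiableOn_weightedGeom_term u n _) isOpen_ball hle hzr'
  have h := (hasSum_weightedGeom hu hz).add ((hd.mul_left z).mul_left (u : ℂ))
  refine h.unique ?_
  convert! hasSum_geometric_of_norm_lt_one hz1 using 2 with n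
  have hne : ((1 + u * n : ℝ) : ℂ) ≠ 0 := by
    have : 0 < 1 + u * n := by positivity
    exact_mod_cast this.ne'
  rw [deriv_div_const, deriv_pow_field, mul_div_assoc', mul_div_assoc', ← add_div,
    div_eq_iff hne]
  rcases n with _ | n
  · simp
  · push_cast
    ring

/-- The function `g = f / z` for the extremal `f` of `diskSet u t`, for which
`g + u z g' = t + (1 - t) (1 + z) / (1 - z)`. -/
noncomputable def extremalQuot (u t : ℝ) (z : ℂ) : ℂ :=
  1 + (2 * (1 - t) : ℝ) * (weightedGeom u z - 1)

theorem extremalQuot_zero (u t : ℝ) : extremalQuot u t 0 = 1 := by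
  simp [extremalQuot, weightedGeom_zero]

theorem differentiableOn_extremalQuot {u : ℝ} (hu : 0 ≤ u) (t : ℝ) :
    DifferentiableOn ℂ (extremalQuot u t) (ball 0 1) := fun _ hz =>
  (((weightedGeom_spec hu hz).1.sub_const 1).const_mul _).const_add 1 |>.differentiableWithinAt

theorem extremalQuot_add {u : ℝ} (hu : 0 ≤ u) (t : ℝ) {z : ℂ} (hz : z ∈ ball (0 : ℂ) 1) :
    extremalQuot u t z + u * (z * deriv (extremalQuot u t) z)
      = 1 + (2 * (1 - t) : ℝ) * ((1 - z)⁻¹ - 1) := by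
  obtain ⟨h1, h2⟩ := weightedGeom_spec hu hz
  have h3 : deriv (extremalQuot u t) z = (2 * (1 - t) : ℝ) * deriv (weightedGeom u) z :=
    (((h1.hasDerivAt.sub_const 1).const_mul _).const_add 1).deriv
  rw [h3, ← h2, extremalQuot]
  ring

theorem re_extremalQuot_add {u : ℝ} (hu : 0 ≤ u) (t : ℝ) {z : ℂ} (hz : z ∈ ball (0 : ℂ) 1) :
    (extremalQuot u t z + u * (z * deriv (extremalQuot u t) z)).re
      = 1 + 2 * (1 - t) * (((1 - z)⁻¹).re - 1) := by
  rw [extremalQuot_add hu t hz, Complex.add_re, Complex.re_ofReal_mul, Complex.sub_re,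
    Complex.one_re]

theorem half_le_re_inv_one_sub {z : ℂ} (hz : z ∈ ball (0 : ℂ) 1) : 1 / 2 ≤ ((1 - z)⁻¹).re := by
  have h : ‖z‖ ^ 2 ≤ 1 := by
    have := (mem_ball_zero_iff.1 hz).le
    nlinarith [norm_nonneg z]
  have hne : 1 - z ≠ 0 := by
    rintro h0
    rw [sub_eq_zero] at h0
    rw [← h0, mem_ball_zero_iff] at hz
    simp at hz
  rw [Complex.inv_re, le_div_iff₀ (Complex.normSq_pos.2 hne), Complex.normSq_apply]
  rw [Complex.sq_norm, Complex.normSq_apply] at h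
  simp only [Complex.sub_re, Complex.one_re, Complex.sub_im, Complex.one_im]
  nlinarith

theorem extremal_mem_diskSet {u t : ℝ} (hu : 0 ≤ u) (ht : t ≤ 1) :
    (fun z => z * extremalQuot u t z) ∈ diskSet u t := by
  refine (mul_mem_diskSet_iff (differentiableOn_extremalQuot hu t) (extremalQuot_zero u t)).2
    fun z hz _ => ?_
  rw [re_extremalQuot_add hu t hz]
  nlinarith [mul_le_mul_of_nonneg_left (half_le_re_inv_one_sub hz) (sub_nonneg.2 ht)]

theorem neg_ofReal_mem_ball {r : ℝ} (h : r ∈ Ioo (0 : ℝ) 1) :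
    (r : ℂ) * (-1) ∈ ball (0 : ℂ) 1 ∧ (r : ℂ) * (-1) ≠ 0 ∧
      ((1 - (r : ℂ) * (-1))⁻¹).re = (1 + r)⁻¹ := by
  refine ⟨?_, ?_, ?_⟩
  · rw [mem_ball_zero_iff, norm_mul, norm_neg, norm_one, Complex.norm_real,
      Real.norm_of_nonneg h.1.le, mul_one]
    exact h.2
  · exact mul_ne_zero (by exact_mod_cast h.1.ne') (by simp)
  · rw [mul_neg_one, sub_neg_eq_add]
    exact_mod_cast Complex.ofReal_re (1 + r)⁻¹

theorem Ioo_mem_nhdsLT_one : Ioo (0 : ℝ) 1 ∈ 𝓝[<] (1 : ℝ) := Ioo_mem_nhdsLT one_pos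

theorem le_of_diskSet_subset {u t t' : ℝ} (hu : 0 ≤ u) (ht : t ≤ 1)
    (h : diskSet u t ⊆ diskSet u t') : t' ≤ t := by
  have hmem := (mul_mem_diskSet_iff (differentiableOn_extremalQuot hu t)
    (extremalQuot_zero u t)).1 (h (extremal_mem_diskSet hu ht))
  have hlim : Tendsto (fun r : ℝ => 1 + 2 * (1 - t) * ((1 + r)⁻¹ - 1)) (𝓝[<] 1) (𝓝 t) := by
    have hc : ContinuousAt (fun r : ℝ => 1 + 2 * (1 - t) * ((1 + r)⁻¹ - 1)) 1 := by
      fun_prop (disch := norm_num)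
    have := hc.tendsto.mono_left (nhdsWithin_le_nhds (s := Iio 1))
    convert! this using 2
    norm_num
    ring
  refine ge_of_tendsto hlim ?_
  filter_upwards [Ioo_mem_nhdsLT_one] with r hr
  obtain ⟨h1, h2, h3⟩ := neg_ofReal_mem_ball hr
  have := hmem _ h1 h2
  rwa [re_extremalQuot_add hu t h1, h3] at this

/-- Harnack's inequality is an equality on the negative axis for the extremal function, so the
difference `D` of the ray argument now has zero derivative. -/
theorem rpow_mul_re_extremalQuot {s r : ℝ} (hs : 0 < s) (t : ℝ) (hr : r ∈ Ioo (0 : ℝ) 1) :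
    r ^ s * (extremalQuot s⁻¹ t (r * (-1))).re
      = r ^ s - (1 - t) * (2 * s * ∫ v in (0 : ℝ)..r, betaKernel s v) := by
  have hu := (inv_pos.2 hs).le
  have hg := differentiableOn_extremalQuot hu t
  have hc := continuous_betaKernel hs.le
  let D : ℝ → ℝ := fun x => x ^ s * (extremalQuot s⁻¹ t (x * (-1))).re -
    (x ^ s - (1 - t) * (2 * s * ∫ v in (0 : ℝ)..x, betaKernel s v))
  have hI : ∀ x, HasDerivAt (fun x => ∫ v in (0 : ℝ)..x, betaKernel s v) (betaKernel s x) x :=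
    fun x => (hc.integral_hasStrictDerivAt 0 x).hasDerivAt
  have hball : ∀ x ∈ Icc 0 r, (x : ℂ) * (-1) ∈ ball (0 : ℂ) 1 := by
    intro x hx
    rw [mem_ball_zero_iff, norm_mul, norm_neg, norm_one, Complex.norm_real,
      Real.norm_of_nonneg hx.1, mul_one]
    exact hx.2.trans_lt hr.2
  have hcont : ContinuousOn D (Icc 0 r) := by
    have h1 : Continuous (fun x => ∫ v in (0 : ℝ)..x, betaKernel s v) :=
      continuous_iff_continuousAt.2 fun x => (hI x).continuousAt
    have h3 : Continuous (fun x : ℝ => x ^ s) := Real.continuous_rpow_const hs.le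
    refine (h3.continuousOn.mul fun x hx => ?_).sub
      (h3.sub ((h1.const_mul _).const_mul _)).continuousOn
    exact (hasDerivAt_re_ray hg (hball x hx)).continuousAt.continuousWithinAt
  have hder : ∀ x ∈ interior (Icc 0 r), HasDerivAt D 0 x := by
    intro x hx
    rw [interior_Icc] at hx
    have hb := hball x (Ioo_subset_Icc_self hx)
    have hpow := Real.hasDerivAt_rpow_const (x := x) (p := s) (Or.inl hx.1.ne')
    convert! (hasDerivAt_rpow_mul_re_ray hg hs.ne' hx.1 hb).sub
      (hpow.sub (((hI x).const_mul (2 * s)).const_mul (1 - t))) using 1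
    have h0 := hx.1
    have e1 : x ^ s = x ^ (s - 1) * x := by rw [Real.rpow_sub_one hx.1.ne']; field_simp
    rw [re_extremalQuot_add hu t hb, (neg_ofReal_mem_ball ⟨hx.1, hx.2.trans hr.2⟩).2.2,
      betaKernel, abs_of_pos h0, e1]
    field_simp
    ring
  have hdiff : DifferentiableOn ℝ D (interior (Icc 0 r)) := fun x hx =>
    (hder x hx).differentiableAt.differentiableWithinAt
  have hm := monotoneOn_of_deriv_nonneg (convex_Icc 0 r) hcont hdiff
    (fun x hx => (hder x hx).deriv.ge)
  have ha := antitoneOn_of_deriv_nonpos (convex_Icc 0 r) hcont hdiff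
    (fun x hx => (hder x hx).deriv.le)
  have hl := left_mem_Icc.2 hr.1.le
  have hr' := right_mem_Icc.2 hr.1.le
  have h0 : D r = D 0 := le_antisymm (ha hl hr' hr.1.le) (hm hl hr' hr.1.le)
  simp only [D, Real.zero_rpow hs.ne', intervalIntegral.integral_same, zero_mul, mul_zero,
    sub_zero] at h0
  exact sub_eq_zero.1 h0

theorem re_add_eq {s : ℝ} (hs : s ≠ 0) (v : ℝ) (a b : ℂ) :
    (a + v * b).re = (1 - s * v) * a.re + s * v * (a + (s⁻¹ : ℝ) * b).re := by
  simp only [Complex.add_re, Complex.re_ofReal_mul]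
  field_simp
  ring

/-- The extremal function is tested at `-r`; as `r → 1` its real part there tends to the height of
the forward curve. -/
theorem le_forwardCurve_of_diskSet_subset {s t v t' : ℝ} (hs : 0 < s) (ht : t ≤ 1)
    (h : diskSet s⁻¹ t ⊆ diskSet v t') : t' ≤ forwardCurve s t v := by
  have hu := (inv_pos.2 hs).le
  have hmem := (mul_mem_diskSet_iff (differentiableOn_extremalQuot hu t)
    (extremalQuot_zero s⁻¹ t)).1 (h (extremal_mem_diskSet hu ht))
  let Φ : ℝ → ℝ := fun r =>
    (1 - s * v) * ((r ^ s - (1 - t) * (2 * s * ∫ x in (0 : ℝ)..r, betaKernel s x)) / r ^ s)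
      + s * v * (1 + 2 * (1 - t) * ((1 + r)⁻¹ - 1))
  have hlim : Tendsto Φ (𝓝[<] 1) (𝓝 (forwardCurve s t v)) := by
    have h1 : ContinuousAt (fun r => ∫ x in (0 : ℝ)..r, betaKernel s x) 1 :=
      ((continuous_betaKernel hs.le).integral_hasStrictDerivAt 0 1).hasDerivAt.continuousAt
    have h2 : ContinuousAt (fun r : ℝ => r ^ s) 1 := (Real.continuous_rpow_const hs.le).continuousAt
    have hc : ContinuousAt Φ 1 := by
      refine (((h2.sub ((h1.const_mul _).const_mul _)).div h2 (by simp)).const_mul _).add ?_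
      fun_prop (disch := norm_num)
    have := hc.tendsto.mono_left (nhdsWithin_le_nhds (s := Iio 1))
    convert! this using 2
    simp only [Φ, Real.one_rpow, div_one]
    rw [forwardCurve, xi0_eq hs, betaInt]
    ring
  refine ge_of_tendsto hlim ?_
  filter_upwards [Ioo_mem_nhdsLT_one] with r hr
  obtain ⟨h1, h2, h3⟩ := neg_ofReal_mem_ball hr
  have h4 := hmem _ h1 h2
  rw [re_add_eq hs.ne', re_extremalQuot_add hu t h1, h3] at h4
  have hpos : 0 < r ^ s := Real.rpow_pos_of_pos hr.1 s
  have h5 : (extremalQuot s⁻¹ t (r * (-1))).re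
      = (r ^ s - (1 - t) * (2 * s * ∫ x in (0 : ℝ)..r, betaKernel s x)) / r ^ s := by
    rw [eq_div_iff hpos.ne', mul_comm, rpow_mul_re_extremalQuot hs t hr]
  rwa [h5] at h4

/-! ### Failure of inclusion when `u` increases. -/

/-- The series is a bounded perturbation of `-log (1 - z) / u`. -/
theorem exists_le_re_weightedGeom {u : ℝ} (hu : 0 < u) :
    ∃ C : ℝ, ∀ z ∈ ball (0 : ℂ) 1, -Real.log ‖1 - z‖ / u - C ≤ (weightedGeom u z).re := by
  -- These coefficients are `O(1 / n²)`. Division by zero gives `c 0 = 1`, consistent with the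
  -- zeroth term `z ^ 0 / 0 = 0` of the logarithmic series.
  let c : ℕ → ℝ := fun n => 1 / (1 + u * n) - 1 / (u * n)
  have hc : Summable fun n => ‖c n‖ := by
    refine Summable.norm (Summable.of_norm_bounded_eventually_nat
      (g := fun n : ℕ => (u ^ 2)⁻¹ * (1 / (n : ℝ) ^ 2))
      ((Real.summable_one_div_nat_pow.2 one_lt_two).mul_left _) ?_)
    filter_upwards [eventually_gt_atTop 0] with n hn
    have hn : (0 : ℝ) < n := by exact_mod_cast hn
    have e : c n = -(1 / (u * n * (1 + u * n))) := by
      simp only [c]; field_simp; ring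
    rw [e, norm_neg, Real.norm_of_nonneg (by positivity), ← one_div, one_div_mul_one_div]
    refine one_div_le_one_div_of_le (by positivity) ?_
    nlinarith [mul_pos hu hn]
  refine ⟨∑' n, ‖c n‖, fun z hz => ?_⟩
  have hz1 := mem_ball_zero_iff.1 hz
  have h := (hasSum_weightedGeom hu.le hz).sub
    ((Complex.hasSum_taylorSeries_neg_log hz1).div_const (u : ℂ))
  have hle : ‖weightedGeom u z - -Complex.log (1 - z) / u‖ ≤ ∑' n, ‖c n‖ := by
    rw [← h.tsum_eq]
    refine tsum_of_norm_bounded hc.hasSum fun n => ?_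
    have e : z ^ n / ((1 + u * n : ℝ) : ℂ) - z ^ n / n / u = z ^ n * (c n : ℂ) := by
      simp only [c]
      push_cast
      ring
    rw [e, norm_mul, norm_pow, Complex.norm_real]
    exact mul_le_of_le_one_left (norm_nonneg _) (pow_le_one₀ (norm_nonneg _) hz1.le)
  have := neg_le_of_abs_le ((Complex.abs_re_le_norm _).trans hle)
  rw [Complex.sub_re, Complex.div_ofReal_re, Complex.neg_re, Complex.log_re] at this
  linarith

theorem not_diskSet_subset_of_lt_of_pos {s t v : ℝ} (hs : 0 < s) (ht : t < 1) (hv : s⁻¹ < v)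
    (t' : ℝ) : ¬ diskSet s⁻¹ t ⊆ diskSet v t' := by
  intro h
  have hu := inv_pos.2 hs
  have hmem := (mul_mem_diskSet_iff (differentiableOn_extremalQuot hu.le t)
    (extremalQuot_zero s⁻¹ t)).1 (h (extremal_mem_diskSet hu.le ht.le))
  obtain ⟨C, hC⟩ := exists_le_re_weightedGeom hu
  have hsv : 0 < s * v - 1 := by
    have := mul_lt_mul_of_pos_left hv hs
    rw [mul_inv_cancel₀ hs.ne'] at this
    linarith
  -- Test points satisfy `1 / (1 - z) = 1 + i y`, on a circle tangent to the unit circle at `1`.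
  -- There `Re (g + z g' / s) = 1` for the extremal `g`, while `Re g` grows like `log y` and has
  -- coefficient `1 - s v < 0`.
  have key : ∀ y : ℝ, 0 < y →
      (s * v - 1) * (1 + 2 * (1 - t) * (s * Real.log y - C - 1)) ≤ s * v - t' := by
    intro y hy
    have hw : (1 + y * Complex.I : ℂ) ≠ 0 := by
      intro h0
      have := congrArg Complex.re h0
      simp at this
    have hlt : ∀ b : ℝ, 0 ≤ b →
        (b < ‖(1 + y * Complex.I : ℂ)‖ ↔ b ^ 2 < 1 + y ^ 2) := by
      intro b hb
      rw [← sq_lt_sq₀ hb (norm_nonneg _), Complex.sq_norm, Complex.normSq_apply]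
      simp [sq]
    set z : ℂ := 1 - (1 + y * Complex.I)⁻¹ with hzdef
    have h1z : 1 - z = (1 + y * Complex.I)⁻¹ := by rw [hzdef]; ring
    have hz' : z = y * Complex.I / (1 + y * Complex.I) := by
      rw [hzdef]; field_simp; ring
    have hz : z ∈ ball (0 : ℂ) 1 := by
      rw [mem_ball_zero_iff, hz', norm_div, div_lt_one (norm_pos_iff.2 hw), norm_mul,
        Complex.norm_I, mul_one, Complex.norm_real, hlt _ (norm_nonneg _), Real.norm_eq_abs, sq_abs]
      linarith
    have hz0 : z ≠ 0 := by
      rw [hz']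
      exact div_ne_zero (mul_ne_zero (by exact_mod_cast hy.ne') Complex.I_ne_zero) hw
    have h4 := hmem z hz hz0
    rw [re_add_eq hs.ne', re_extremalQuot_add hu.le t hz, h1z, inv_inv] at h4
    simp only [Complex.add_re, Complex.one_re, Complex.re_ofReal_mul, Complex.I_re, mul_zero,
      add_zero, sub_self, mul_one] at h4
    have h5 := hC z hz
    rw [h1z, norm_inv, Real.log_inv, neg_neg, div_inv_eq_mul] at h5
    have h6 : Real.log y ≤ Real.log ‖(1 + y * Complex.I : ℂ)‖ :=
      Real.log_le_log hy ((hlt y hy.le).2 (by linarith)).le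
    have h7 : s * Real.log y - C - 1 ≤ (weightedGeom s⁻¹ z).re - 1 := by
      have := mul_le_mul_of_nonneg_right h6 hs.le
      linarith
    have h8 : (extremalQuot s⁻¹ t z).re = 1 + 2 * (1 - t) * ((weightedGeom s⁻¹ z).re - 1) := by
      rw [extremalQuot, Complex.add_re, Complex.re_ofReal_mul, Complex.sub_re, Complex.one_re]
    have h9 := mul_le_mul_of_nonneg_left h7 (mul_pos two_pos (sub_pos.2 ht)).le
    have h10 := mul_le_mul_of_nonneg_left h9 hsv.le
    rw [h8] at h4
    linarith
  have htend : Tendsto (fun y : ℝ => (s * v - 1) * (1 + 2 * (1 - t) * (s * Real.log y - C - 1)))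
      atTop atTop := by
    refine Tendsto.const_mul_atTop hsv (tendsto_atTop_add_const_left _ _
      (Tendsto.const_mul_atTop (mul_pos two_pos (sub_pos.2 ht)) ?_))
    simp only [sub_sub, sub_eq_add_neg _ (C + 1)]
    exact tendsto_atTop_add_const_right _ _ (Tendsto.const_mul_atTop hs Real.tendsto_log_atTop)
  obtain ⟨y, hy1, hy2⟩ :=
    ((htend.eventually_gt_atTop (s * v - t')).and (eventually_gt_atTop 0)).exists
  exact absurd (key y hy2) (not_le.2 hy1)

theorem not_diskSet_subset_of_lt {u t v : ℝ} (hu : 0 ≤ u) (ht : t < 1) (hv : u < v)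
    (t' : ℝ) : ¬ diskSet u t ⊆ diskSet v t' := by
  rcases hu.eq_or_lt with rfl | hu
  · intro h
    -- For `u = 0` any parameter strictly between `0` and `v` works: its set at level `t` lies in
    -- `diskSet 0 t`, and the positive case applies to it.
    have hs : 0 < (v / 2)⁻¹ := by positivity
    refine not_diskSet_subset_of_lt_of_pos hs ht (v := v) (by rw [inv_inv]; linarith) t' ?_
    exact (diskSet_subset_of_le_forwardCurve hs ht le_rfl (by rw [inv_inv]; linarith)
      (le_forwardCurve hs ht.le (by rw [inv_inv]; linarith))).trans h
  · have := not_diskSet_subset_of_lt_of_pos (inv_pos.2 hu) ht (v := v) (by rwa [inv_inv]) t'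
    rwa [inv_inv] at this

theorem diskSet_subset_iff {s t v t' : ℝ} (hs : 0 < s) (ht : t < 1) (hv : 0 ≤ v) :
    diskSet s⁻¹ t ⊆ diskSet v t' ↔ v ≤ s⁻¹ ∧ t' ≤ forwardCurve s t v := by
  refine ⟨fun h => ⟨?_, le_forwardCurve_of_diskSet_subset hs ht.le h⟩,
    fun h => diskSet_subset_of_le_forwardCurve hs ht hv h.1 h.2⟩
  by_contra! hlt
  exact not_diskSet_subset_of_lt (inv_pos.2 hs).le ht hlt t' h

/-! ### Quasi-suprema and quasi-infima. -/

/-- The sets `diskSet u t` with `u ∈ U` and `t ∈ [0, 1]`. -/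
def diskFamily (U : Set ℝ) : Set (Set (ℂ → ℂ)) :=
  {C | ∃ u ∈ U, ∃ t ∈ Icc (0 : ℝ) 1, C = diskSet u t}

theorem forwardCurve_tDown {P : ℝ × ℝ} {s : ℝ} (hs : 0 < s) (hsP : s ≤ P.1) :
    forwardCurve s (tDown P s) P.1⁻¹ = P.2 :=
  ((eq_tDown_iff hs hsP).1 rfl).symm

theorem tDown_le_iff {P : ℝ × ℝ} {s t : ℝ} (hs : 0 < s) (hsP : s ≤ P.1) :
    tDown P s ≤ t ↔ P.2 ≤ forwardCurve s t P.1⁻¹ := by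
  have h0 : 0 ≤ P.1⁻¹ := (inv_pos.2 (hs.trans_le hsP)).le
  conv_rhs => rw [← forwardCurve_tDown hs hsP]
  exact (forwardCurve_strictMono hs h0).le_iff_le.symm

theorem lt_tDown_iff {P : ℝ × ℝ} {s t : ℝ} (hs : 0 < s) (hsP : s ≤ P.1) :
    t < tDown P s ↔ forwardCurve s t P.1⁻¹ < P.2 := by
  rw [← not_le, tDown_le_iff hs hsP, not_le]

theorem tDown_self {P : ℝ × ℝ} (hP : 0 < P.1) : tDown P P.1 = P.2 := by
  simp [tDown, hP.ne']

theorem tDown_lt_one {P : ℝ × ℝ} {s : ℝ} (hs : 0 < s) (hsP : s ≤ P.1) (hP : P.2 < 1) :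
    tDown P s < 1 := by
  by_contra! h
  have : forwardCurve s 1 P.1⁻¹ ≤ forwardCurve s (tDown P s) P.1⁻¹ :=
    (forwardCurve_strictMono hs (inv_pos.2 (hs.trans_le hsP)).le).monotone h
  rw [forwardCurve_tDown hs hsP] at this
  simp only [forwardCurve, sub_self, zero_mul, add_zero] at this
  linarith

theorem tendsto_tDown_nhdsGT {P : ℝ × ℝ} {s : ℝ} (hs : 0 < s) (hsP : s ≤ P.1) :
    Tendsto (tDown P) (𝓝[>] s) (𝓝 (tDown P s)) := by
  have hid : Tendsto (fun r : ℝ => r) (𝓝[>] s) (𝓝 s) :=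
    tendsto_nhdsWithin_of_tendsto_nhds tendsto_id
  have h := ((hid.div_const P.1).const_sub 1).mul (tendsto_xi0_nhdsGT hs)
  refine (h.const_sub P.2).div (h.const_sub 1) ?_
  have := one_sub_mul_xi0_pos hs (inv_pos.2 (hs.trans_le hsP)).le
  rw [div_eq_mul_inv]
  exact this.ne'

section

variable {U : Set ℝ} {P₁ P₂ : ℝ × ℝ}

/-- This rules out inclusions from one point of the upper envelope to another with smaller `v`. -/
theorem min_forwardCurve_lt (hs₁ : 0 < P₁.1) (h₁ : P₁.2 < 1) (h₂ : P₂.2 < 1) (hs : P₁.1 < P₂.1)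
    (habove : forwardCurve P₁.1 P₁.2 P₂.1⁻¹ < P₂.2) {s v : ℝ} (hsP : P₂.1 ≤ s) (hv : 0 ≤ v)
    (hvs : v < s⁻¹) :
    forwardCurve s (min (forwardCurve P₁.1 P₁.2 s⁻¹) (forwardCurve P₂.1 P₂.2 s⁻¹)) v <
      min (forwardCurve P₁.1 P₁.2 v) (forwardCurve P₂.1 P₂.2 v) := by
  have hs₂ := hs₁.trans hs
  have hs0 := hs₂.trans_le hsP
  have hmono := forwardCurve_strictMono hs0 hv
  refine lt_min ?_ ?_
  · exact (hmono.monotone (min_le_left _ _)).trans_lt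
      (forwardCurve_forwardCurve_lt hs₁ (hs.trans_le hsP) h₁ hvs)
  · rcases hsP.eq_or_lt with rfl | hlt
    -- At `s = s₂` the envelope lies strictly below `P₂`, so monotonicity in the level replaces the
    -- concatenation inequality.
    · exact hmono (min_lt_of_left_lt habove)
    · exact (hmono.monotone (min_le_right _ _)).trans_lt
        (forwardCurve_forwardCurve_lt hs₂ hlt h₂ hvs)

theorem qsup_diskFamily (hU : U ⊆ Ici 0) (hP₁ : P₁ ∈ Omega) (hP₂ : P₂ ∈ Omega) (hs₁ : 0 < P₁.1)
    (hs : P₁.1 < P₂.1) (habove : forwardCurve P₁.1 P₁.2 P₂.1⁻¹ < P₂.2) :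
    qsup (diskFamily U) (diskSet P₁.1⁻¹ P₁.2) (diskSet P₂.1⁻¹ P₂.2) =
      {C | ∃ v ∈ U, v ≤ P₂.1⁻¹ ∧
        C = diskSet v (min (forwardCurve P₁.1 P₁.2 v) (forwardCurve P₂.1 P₂.2 v))} := by
  obtain ⟨-, h₁0, h₁⟩ := hP₁
  obtain ⟨-, h₂0, h₂⟩ := hP₂
  have hs₂ := hs₁.trans hs
  have hinv : P₂.1⁻¹ ≤ P₁.1⁻¹ := (inv_le_inv₀ hs₂ hs₁).2 hs.le
  set τ : ℝ → ℝ := fun v => min (forwardCurve P₁.1 P₁.2 v) (forwardCurve P₂.1 P₂.2 v)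
  have hub : ∀ {v t : ℝ}, 0 ≤ v → (diskSet P₁.1⁻¹ P₁.2 ∪ diskSet P₂.1⁻¹ P₂.2 ⊆ diskSet v t ↔
      v ≤ P₂.1⁻¹ ∧ t ≤ τ v) := by
    intro v t hv
    rw [union_subset_iff, diskSet_subset_iff hs₁ h₁ hv, diskSet_subset_iff hs₂ h₂ hv, le_min_iff]
    exact ⟨fun h => ⟨h.2.1, h.1.2, h.2.2⟩, fun h => ⟨⟨h.1.trans hinv, h.2.1⟩, h.1, h.2.2⟩⟩
  have hτ0 : ∀ {v : ℝ}, v ≤ P₂.1⁻¹ → 0 ≤ τ v := fun hv =>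
    le_min (h₁0.trans (le_forwardCurve hs₁ h₁.le (hv.trans hinv)))
      (h₂0.trans (le_forwardCurve hs₂ h₂.le hv))
  have hτ1 : ∀ {v : ℝ}, 0 ≤ v → τ v < 1 := fun hv =>
    min_lt_of_left_lt (forwardCurve_lt_one hs₁ h₁ hv)
  ext C
  constructor
  · rintro ⟨⟨v, hvU, t, ht, rfl⟩, hC, hmin⟩
    have hv : 0 ≤ v := hU hvU
    obtain ⟨hv2, htτ⟩ := (hub hv).1 hC
    refine ⟨v, hvU, hv2, ?_⟩
    by_contra hne
    exact hmin ⟨diskSet v (τ v), ⟨v, hvU, τ v, ⟨hτ0 hv2, (hτ1 hv).le⟩, rfl⟩,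
      (hub hv).2 ⟨hv2, le_rfl⟩, (diskSet_anti v htτ).ssubset_of_ne (Ne.symm hne)⟩
  · rintro ⟨v, hvU, hv2, rfl⟩
    have hv : 0 ≤ v := hU hvU
    refine ⟨⟨v, hvU, τ v, ⟨hτ0 hv2, (hτ1 hv).le⟩, rfl⟩, (hub hv).2 ⟨hv2, le_rfl⟩, ?_⟩
    rintro ⟨D, ⟨v', hvU', t', ht', rfl⟩, hD, hDC⟩
    have hv' : 0 ≤ v' := hU hvU'
    obtain ⟨hv2', htτ'⟩ := (hub hv').1 hD
    have ht1 : t' < 1 := htτ'.trans_lt (hτ1 hv')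
    -- A smaller `v'` forbids inclusion in `C`, an equal one makes the inclusion non-proper, and a
    -- larger one starts a curve that stays strictly below the envelope at `v`.
    rcases lt_trichotomy v' v with hlt | rfl | hlt
    · exact not_diskSet_subset_of_lt hv' ht1 hlt _ hDC.1
    · exact hDC.2 (diskSet_anti v' htτ')
    · have hpos : 0 < v' := hv.trans_lt hlt
      have hsub := hDC.1
      rw [← inv_inv v', diskSet_subset_iff (inv_pos.2 hpos) ht1 hv] at hsub
      have h := min_forwardCurve_lt hs₁ h₁ h₂ hs habove (s := v'⁻¹) (v := v)
        ((le_inv_comm₀ hs₂ hpos).2 hv2') hv (by rwa [inv_inv])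
      rw [inv_inv] at h
      exact absurd (hsub.2.trans ((forwardCurve_strictMono (inv_pos.2 hpos) hv).monotone htτ'))
        (not_le.2 h)

/-- The curve of `(s, tDown P s)` passes through `P`. Switching curves at `s'` would lose strictly
and end below `P`, so the point at `s'` lies below the level `tDown P s'` needed to reach `P`. -/
theorem forwardCurve_max_tDown_lt (hs₁ : 0 < P₁.1) (h₁ : P₁.2 < 1) (h₂ : P₂.2 < 1)
    (hs : P₁.1 < P₂.1) (habove : forwardCurve P₁.1 P₁.2 P₂.1⁻¹ < P₂.2) {s s' : ℝ} (hs0 : 0 < s)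
    (hss' : s < s') (hsP : s' ≤ P₁.1) :
    forwardCurve s (max (tDown P₁ s) (tDown P₂ s)) s'⁻¹ < max (tDown P₁ s') (tDown P₂ s') := by
  have hs0' := hs0.trans hss'
  have aux : ∀ P : ℝ × ℝ, P.2 < 1 → s' < P.1 →
      forwardCurve s (tDown P s) s'⁻¹ < tDown P s' := by
    intro P hP hlt
    rw [lt_tDown_iff hs0' hlt.le, ← forwardCurve_tDown hs0 (hss'.trans hlt).le]
    exact forwardCurve_forwardCurve_lt hs0 hss'
      (tDown_lt_one hs0 (hss'.trans hlt).le hP) ((inv_lt_inv₀ (hs0'.trans hlt) hs0').2 hlt)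
  rcases le_total (tDown P₁ s) (tDown P₂ s) with h | h
  · rw [max_eq_right h]
    exact lt_max_of_lt_right (aux P₂ h₂ (hsP.trans_lt hs))
  · rw [max_eq_left h]
    rcases hsP.eq_or_lt with rfl | hlt
    -- At `s' = s₁` the curve passes through `P₁` itself, with no strict loss; the strictness comes
    -- from `P₂`, which `P₁` fails to reach by `habove`.
    · refine lt_max_of_lt_right ?_
      rwa [forwardCurve_tDown hs0 hss'.le, lt_tDown_iff hs₁ hs.le]
    · exact lt_max_of_lt_left (aux P₁ h₁ hlt)

theorem qinf_diskFamily (hU : U ⊆ Ici 0) (hU' : Ioi 0 ⊆ U) (hP₁ : P₁ ∈ Omega) (hP₂ : P₂ ∈ Omega)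
    (hs₁ : 0 < P₁.1) (hs : P₁.1 < P₂.1) (habove : forwardCurve P₁.1 P₁.2 P₂.1⁻¹ < P₂.2) :
    qinf (diskFamily U) (diskSet P₁.1⁻¹ P₁.2) (diskSet P₂.1⁻¹ P₂.2) =
      {C | ∃ s, 0 < s ∧ s ≤ P₁.1 ∧ 0 ≤ max (tDown P₁ s) (tDown P₂ s) ∧
        C = diskSet s⁻¹ (max (tDown P₁ s) (tDown P₂ s))} := by
  obtain ⟨-, h₁0, h₁⟩ := hP₁
  obtain ⟨-, h₂0, h₂⟩ := hP₂
  have hs₂ := hs₁.trans hs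
  have hinv : P₂.1⁻¹ ≤ P₁.1⁻¹ := (inv_le_inv₀ hs₂ hs₁).2 hs.le
  set σ : ℝ → ℝ := fun s => max (tDown P₁ s) (tDown P₂ s)
  have hlb : ∀ {s t : ℝ}, 0 < s → t < 1 →
      (diskSet s⁻¹ t ⊆ diskSet P₁.1⁻¹ P₁.2 ∩ diskSet P₂.1⁻¹ P₂.2 ↔ s ≤ P₁.1 ∧ σ s ≤ t) := by
    intro s t hs0 ht
    rw [subset_inter_iff, diskSet_subset_iff hs0 ht (inv_pos.2 hs₁).le,
      diskSet_subset_iff hs0 ht (inv_pos.2 hs₂).le, inv_le_inv₀ hs₁ hs0, inv_le_inv₀ hs₂ hs0,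
      max_le_iff]
    constructor
    · rintro ⟨⟨h1, h2⟩, h3, h4⟩
      exact ⟨h1, (tDown_le_iff hs0 h1).2 h2, (tDown_le_iff hs0 h3).2 h4⟩
    · rintro ⟨h1, h2, h4⟩
      have h3 := h1.trans hs.le
      exact ⟨⟨h1, (tDown_le_iff hs0 h1).1 h2⟩, h3, (tDown_le_iff hs0 h3).1 h4⟩
  have hσ1 : ∀ {s : ℝ}, 0 < s → s ≤ P₁.1 → σ s < 1 := fun h0 h =>
    max_lt (tDown_lt_one h0 h h₁) (tDown_lt_one h0 (h.trans hs.le) h₂)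
  have hσP : 0 ≤ σ P₁.1 := le_max_of_le_left (by rwa [tDown_self hs₁])
  have hmem : ∀ {s t : ℝ}, 0 < s → 0 ≤ t → t < 1 → diskSet s⁻¹ t ∈ diskFamily U :=
    fun h0 ht ht1 => ⟨_, hU' (inv_pos.2 h0), _, ⟨ht, ht1.le⟩, rfl⟩
  have hpos : ∀ {u t : ℝ}, 0 ≤ u → t < 1 →
      diskSet u t ⊆ diskSet P₁.1⁻¹ P₁.2 ∩ diskSet P₂.1⁻¹ P₂.2 → 0 < u := by
    intro u t hu ht h
    by_contra! hu0
    exact not_diskSet_subset_of_lt hu ht (hu0.trans_lt (inv_pos.2 hs₁)) _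
      (h.trans inter_subset_left)
  ext C
  constructor
  · rintro ⟨⟨u, huU, t, ⟨ht0, ht1⟩, rfl⟩, hC, hmax⟩
    have hu : 0 ≤ u := hU huU
    -- Level `1` gives the smallest set of the family, properly contained in the common subset at `s
    -- = s₁`.
    rcases ht1.eq_or_lt with rfl | ht1
    · refine absurd ⟨diskSet P₁.1⁻¹ (σ P₁.1), hmem hs₁ hσP (hσ1 hs₁ le_rfl), ?_,
        (hlb hs₁ (hσ1 hs₁ le_rfl)).2 ⟨le_rfl, le_rfl⟩⟩ hmax
      have hlt := hσ1 hs₁ le_rfl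
      rw [diskSet_one hu]
      refine ⟨identitySet_subset_diskSet _ hlt.le, fun h => ?_⟩
      rw [← diskSet_one (inv_pos.2 hs₁).le] at h
      exact absurd (le_of_diskSet_subset (inv_pos.2 hs₁).le hlt.le h) (not_le.2 hlt)
    · obtain ⟨s, hs0, rfl⟩ : ∃ s, 0 < s ∧ u = s⁻¹ :=
        ⟨u⁻¹, inv_pos.2 (hpos hu ht1 hC), (inv_inv u).symm⟩
      obtain ⟨hsP, hσt⟩ := (hlb hs0 ht1).1 hC
      rcases le_or_gt 0 (σ s) with hσ | hσ
      · refine ⟨s, hs0, hsP, hσ, ?_⟩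
        by_contra hne
        exact hmax ⟨diskSet s⁻¹ (σ s), hmem hs0 hσ (hσ1 hs0 hsP),
          (diskSet_anti _ hσt).ssubset_of_ne hne, (hlb hs0 (hσ1 hs0 hsP)).2 ⟨hsP, le_rfl⟩⟩
      -- If the envelope is negative at `s`, right continuity keeps it negative at some larger `s' <
      -- s₁`; the set at `s'` with level `0` is then a strictly larger common subset.
      · have hlt : s < P₁.1 := hsP.lt_of_ne (by rintro rfl; exact absurd hσP (not_le.2 hσ))
        have hlim : Tendsto σ (𝓝[>] s) (𝓝 (σ s)) :=
          (tendsto_tDown_nhdsGT hs0 hsP).max (tendsto_tDown_nhdsGT hs0 (hsP.trans hs.le))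
        obtain ⟨s', hσ', hs1, hs2⟩ :=
          ((hlim.eventually_lt_const hσ).and (Ioo_mem_nhdsGT hlt)).exists
        have hs0' := hs0.trans hs1
        refine absurd ⟨diskSet s'⁻¹ 0, hmem hs0' le_rfl one_pos, ⟨?_, ?_⟩,
          (hlb hs0' one_pos).2 ⟨hs2.le, hσ'.le⟩⟩ hmax
        · have hle : s'⁻¹ ≤ s⁻¹ := (inv_le_inv₀ hs0' hs0).2 hs1.le
          exact (diskSet_subset_iff hs0 ht1 (inv_pos.2 hs0').le).2
            ⟨hle, ht0.trans (le_forwardCurve hs0 ht1.le hle)⟩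
        · exact not_diskSet_subset_of_lt (inv_pos.2 hs0').le one_pos
            ((inv_lt_inv₀ hs0' hs0).2 hs1) t
  · rintro ⟨s, hs0, hsP, hσ, rfl⟩
    have hσs := hσ1 hs0 hsP
    refine ⟨hmem hs0 hσ hσs, (hlb hs0 hσs).2 ⟨hsP, le_rfl⟩, ?_⟩
    rintro ⟨D, ⟨u, huU, t, ⟨ht0, ht1⟩, rfl⟩, hCD, hD⟩
    have hu : 0 ≤ u := hU huU
    rcases ht1.eq_or_lt with rfl | ht1
    · rw [diskSet_one hu] at hCD
      exact hCD.2 (identitySet_subset_diskSet _ hσs.le)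
    · obtain ⟨s', hs0', rfl⟩ : ∃ s, 0 < s ∧ u = s⁻¹ :=
        ⟨u⁻¹, inv_pos.2 (hpos hu ht1 hD), (inv_inv u).symm⟩
      obtain ⟨hsP', hσt⟩ := (hlb hs0' ht1).1 hD
      obtain ⟨hle, htF⟩ := (diskSet_subset_iff hs0 hσs hu).1 hCD.1
      rcases ((inv_le_inv₀ hs0' hs0).1 hle).eq_or_lt with rfl | hlt
      · exact hCD.2 (diskSet_anti _ hσt)
      · exact absurd (hσt.trans htF)
          (not_le.2 (forwardCurve_max_tDown_lt hs₁ h₁ h₂ hs habove hs0 hlt hsP'))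

end

/-! ### Return to the parameter `s`. -/

theorem closure_Omega : closure Omega = Ici 0 ×ˢ Icc 0 1 := by
  rw [Omega, closure_prod_eq, closure_Ici, closure_Ico zero_ne_one]

theorem familyFin_eq_diskFamily : familyFin = diskFamily (Ioi 0) := by
  ext C
  rw [familyFin, closure_Omega]
  constructor
  · rintro ⟨⟨s, t⟩, ⟨hs, ht⟩, rfl⟩
    rcases (mem_Ici.1 hs).eq_or_lt with h | h
    -- The case `s = 0` gives the identity set, represented by level `1` at any positive `u`; `u =
    -- 1` is an arbitrary choice.
    · refine ⟨1, mem_Ioi.2 one_pos, 1, ⟨zero_le_one, le_rfl⟩, ?_⟩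
      rw [diskSet_one zero_le_one, ← h, setA_zero]
    · exact ⟨s⁻¹, inv_pos.2 h, t, ht, setA_eq_diskSet h t⟩
  · rintro ⟨u, hu, t, ht, rfl⟩
    have hu' : 0 < u⁻¹ := inv_pos.2 hu
    exact ⟨(u⁻¹, t), ⟨hu'.le, ht⟩, by rw [setA_eq_diskSet hu', inv_inv]⟩

theorem familyA_eq_diskFamily : familyA = diskFamily (Ici 0) := by
  ext C
  rw [familyA, familyFin_eq_diskFamily]
  simp only [setAInf_eq_diskSet]
  constructor
  · rintro (⟨u, hu, h⟩ | h)
    · exact ⟨u, Ioi_subset_Ici_self hu, h⟩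
    · exact ⟨0, mem_Ici.2 le_rfl, h⟩
  · rintro ⟨u, hu, h⟩
    rcases (mem_Ici.1 hu).eq_or_lt with rfl | hu
    · exact Or.inr h
    · exact Or.inl ⟨u, hu, h⟩

theorem tUp_eq_forwardCurve (P : ℝ × ℝ) (s : ℝ) : tUp P s = forwardCurve P.1 P.2 s⁻¹ := by
  rw [tUp, forwardCurve, div_eq_mul_inv]

theorem tUpInf_eq_forwardCurve (P : ℝ × ℝ) : tUpInf P = forwardCurve P.1 P.2 0 := by
  simp [tUpInf, forwardCurve]

theorem theorem4p4 (P₁ P₂ : ℝ × ℝ) (hP₁ : P₁ ∈ Omega) (hP₂ : P₂ ∈ Omega)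
    (hs : P₁.1 < P₂.1) (habove : tUp P₁ P₂.1 < P₂.2) :
    -- the whole family, with the sets for `s = ∞`
    (qsup familyA (setA P₁.1 P₁.2) (setA P₂.1 P₂.2) =
        {C | ∃ s, P₂.1 ≤ s ∧ C = setA s (min (tUp P₁ s) (tUp P₂ s))} ∪
          {setAInf (min (tUpInf P₁) (tUpInf P₂))} ∧
      qinf familyA (setA P₁.1 P₁.2) (setA P₂.1 P₂.2) =
        {C | ∃ s, 0 < s ∧ s ≤ P₁.1 ∧ 0 ≤ max (tDown P₁ s) (tDown P₂ s) ∧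
          C = setA s (max (tDown P₁ s) (tDown P₂ s))}) ∧
    -- the family restricted to finite `s`
    (qsup familyFin (setA P₁.1 P₁.2) (setA P₂.1 P₂.2) =
        {C | ∃ s, P₂.1 ≤ s ∧ C = setA s (min (tUp P₁ s) (tUp P₂ s))} ∧
      qinf familyFin (setA P₁.1 P₁.2) (setA P₂.1 P₂.2) =
        {C | ∃ s, 0 < s ∧ s ≤ P₁.1 ∧ 0 ≤ max (tDown P₁ s) (tDown P₂ s) ∧
          C = setA s (max (tDown P₁ s) (tDown P₂ s))}) := by
  -- If `s₁ = 0`, then `ξ₀(0) = 1` makes the forward curve of `P₁` equal to `1` at `s₂`, leaving no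
  -- room for `t₂ < 1` above it.
  have hs₁ : 0 < P₁.1 := by
    refine lt_of_le_of_ne hP₁.1 fun h => ?_
    have : tUp P₁ P₂.1 = 1 := by simp [tUp, xi0, ← h]
    exact absurd hP₂.2.2 (not_lt.2 (this ▸ habove.le))
  have hs₂ := hs₁.trans hs
  have hinf : {C | ∃ s, 0 < s ∧ s ≤ P₁.1 ∧ 0 ≤ max (tDown P₁ s) (tDown P₂ s) ∧
      C = setA s (max (tDown P₁ s) (tDown P₂ s))} =
      {C | ∃ s, 0 < s ∧ s ≤ P₁.1 ∧ 0 ≤ max (tDown P₁ s) (tDown P₂ s) ∧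
        C = diskSet s⁻¹ (max (tDown P₁ s) (tDown P₂ s))} := by
    ext C
    refine exists_congr fun s => and_congr_right fun h => ?_
    rw [setA_eq_diskSet h]
  have hsup : {C | ∃ s, P₂.1 ≤ s ∧ C = setA s (min (tUp P₁ s) (tUp P₂ s))} =
      {C | ∃ v ∈ Ioi (0 : ℝ), v ≤ P₂.1⁻¹ ∧
        C = diskSet v (min (forwardCurve P₁.1 P₁.2 v) (forwardCurve P₂.1 P₂.2 v))} := by
    ext C
    constructor
    · rintro ⟨s, h, rfl⟩
      have hs0 := hs₂.trans_le h
      exact ⟨s⁻¹, inv_pos.2 hs0, (inv_le_inv₀ hs0 hs₂).2 h, by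
        rw [setA_eq_diskSet hs0, tUp_eq_forwardCurve, tUp_eq_forwardCurve]⟩
    · rintro ⟨v, hv, h, rfl⟩
      have hv' : 0 < v⁻¹ := inv_pos.2 hv
      exact ⟨v⁻¹, (le_inv_comm₀ hs₂ hv).2 h, by
        rw [setA_eq_diskSet hv', tUp_eq_forwardCurve, tUp_eq_forwardCurve, inv_inv]⟩
  rw [tUp_eq_forwardCurve] at habove
  rw [hinf, hsup, familyA_eq_diskFamily, familyFin_eq_diskFamily, setA_eq_diskSet hs₁,
    setA_eq_diskSet hs₂]
  refine ⟨⟨?_, qinf_diskFamily Subset.rfl Ioi_subset_Ici_self hP₁ hP₂ hs₁ hs habove⟩,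
    qsup_diskFamily Ioi_subset_Ici_self hP₁ hP₂ hs₁ hs habove,
    qinf_diskFamily Ioi_subset_Ici_self Subset.rfl hP₁ hP₂ hs₁ hs habove⟩
  rw [qsup_diskFamily Subset.rfl hP₁ hP₂ hs₁ hs habove, setAInf_eq_diskSet,
    tUpInf_eq_forwardCurve, tUpInf_eq_forwardCurve]
  ext C
  constructor
  · rintro ⟨v, hv, h⟩
    rcases (mem_Ici.1 hv).eq_or_lt with rfl | hv
    · exact Or.inr h.2
    · exact Or.inl ⟨v, hv, h⟩
  · rintro (⟨v, hv, h⟩ | h)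
    · exact ⟨v, Ioi_subset_Ici_self hv, h⟩
    · exact ⟨0, mem_Ici.2 le_rfl, (inv_pos.2 hs₂).le, h⟩
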